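/- Let $\mathbb{F}_q$ be a finite field with $q$ elements, let $s\ge 3$ with $s\neq 4$, let $0\le h<k$ be integers, and put $n=sk+h$. For $1\le i\le s-1$ put $N_i=ik+h$, let $f_i$ be any primitive polynomial of degree $N_i$ over $\mathbb{F}_q$ (monic, irreducible, with a root that generates $\mathbb{F}_{q^{N_i}}^*$), and let $\mathbf{P}_i$ be its companion matrix (ones on the superdiagonal, and last row the negatives of the coefficients $a_0,\dots,a_{N_i-1}$ of $f_i$). Let $G_i\le \mathrm{GL}_n(\mathbb{F}_q)$ be the cyclic group generated by $\mathrm{diag}(\mathbf{I}_{(s-i-1)k},\mathbf{I}_k,\mathbf{P}_i)$. For a matrix $\mathbf{U}$ write $\mathbf{U}^{(j)}$ for its first $j$ rows, $\mathbf{U}^{[j]}$ for what remains when these are deleted, and $\mathrm{rs}(\mathbf{U})$ for its row space. Define the $(n-1)\times n$ matrices $$\mathbf{A}_i=\begin{bmatrix}\mathbf 0&\mathbf I_k&\mathbf I_{N_i}^{(k)}\\ \mathbf 0&\mathbf 0&\mathbf I_{N_i}^{[k]}\\ \mathbf I_{(s-i-1)k}&\mathbf 0&\mathbf 0\\ \mathbf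 0&\mathbf 0&\mathbf I_{N_i}^{(k-1)}\end{bmatrix},\qquad \mathbf{B}_i=\begin{bmatrix}\mathbf 0&\mathbf I_k&\mathbf 0\\ \mathbf 0&\mathbf 0&\mathbf I_{N_i}^{[k]}\\ \mathbf I_{(s-i-1)k}&\mathbf 0&\mathbf 0\\ \mathbf 0&\mathbf 0&\mathbf I_{N_i}^{(k-1)}\end{bmatrix},$$ and let $\mathbf{M}$ be the $(n-1)\times n$ matrix whose rows are the unit vectors $e_n,e_{n-1},\dots,e_2$, in this order. Let $\mathcal{W}=\{\mathbf{A}_ig,\ \mathbf{B}_i,\ \mathbf{M}: g\in G_i,\ 1\le i\le s-1\}$, and define the subspace code and the flag code $$\mathscr{C}=\{\mathrm{rs}(\mathbf{W}):\mathbf{W}\in\mathcal{W}\},\qquad \mathcal{C}=\{(\mathrm{rs}(\mathbf{W}^{(1)}),\dots,\mathrm{rs}(\mathbf{W}^{(n-1)})):\mathbf{W}\in\mathcal{W}\}.$$ For $1\le m\le n-1$ let $\mathcal{C}_m=\{\mathrm{rs}(\mathbf{W}^{(m)}):\mathbf{W}\in\mathcal{W}\}$ be the $m$-projected code of $\mathcal{C}$.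 For subspaces $U,V$ of $\mathbb{F}_q^n$ let $d_S(U,V)=\dim(U+V)-\dim(U\cap V)$, and let $d_S(\mathcal{C}_m)$ be the minimum of $d_S(U,V)$ over distinct $U,V\in\mathcal{C}_m$. Then $$|\mathcal{C}|=|\mathscr{C}|=\sum_{i=1}^{s-1}q^{ik+h}+1,$$ and for every $m\in\{k+1,k+2,\dots,k+h\}\cup\{jk+h: 2\le j\le s-2\}$ all members of $\mathcal{C}_m$ have dimension $m$, $$d_S(\mathcal{C}_m)=2k\qquad\text{and}\qquad |\mathcal{C}_m|=\sum_{i=1}^{s-1}q^{ik+h}+1.$$ -/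

import Mathlib

open scoped Polynomial

namespace FlagCode

noncomputable section

variable {F : Type*} [Field F]

/-! ### Subspaces of `F^n`, their distance, and row spaces -/

/-- The subspace distance `dim (U + V) - dim (U ∩ V)`. No truncation occurs, since
`U ∩ V` is contained in `U + V`. -/
def subspaceDist {n : ℕ} (U V : Submodule F (Fin n → F)) : ℕ :=
  Module.finrank F ↥(U ⊔ V) - Module.finrank F ↥(U ⊓ V)

/-- The minimum distance of a subspace code. It is a true minimum as soon as the code has two
distinct members; otherwise the value is `0`. -/
def minDist {n : ℕ} (S : Set (Submodule F (Fin n → F))) : ℕ :=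
  sInf {d | ∃ U ∈ S, ∃ V ∈ S, U ≠ V ∧ d = subspaceDist U V}

/-- The row space of a matrix. -/
def rowSpace {ι : Type*} {n : ℕ} (W : Matrix ι (Fin n) F) : Submodule F (Fin n → F) :=
  Submodule.span F (Set.range W.row)

/-- The submatrix formed by the first `j` rows. -/
def firstRows {l n : ℕ} (W : Matrix (Fin l) (Fin n) F) (j : ℕ) :
    Matrix {r : Fin l // (r : ℕ) < j} (Fin n) F :=
  W.submatrix (fun r => r.1) id

/-! ### Flags -/

/-- Sequences of subspaces of `F^n` indexed by `1, ..., n - 1`, the ambient type of full flags. -/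
abbrev FlagSeq (F : Type*) [Field F] (n : ℕ) : Type _ :=
  {j : ℕ // 1 ≤ j ∧ j ≤ n - 1} → Submodule F (Fin n → F)

/-- The sequence of the row spaces of the first `1, 2, ..., n - 1` rows of a matrix. -/
def flagOf {n : ℕ} (W : Matrix (Fin (n - 1)) (Fin n) F) : FlagSeq F n :=
  fun j => rowSpace (firstRows W j)

/-- The `m`-projected code of a code of full flags: the `m`-dimensional components of its flags. -/
def projectedCode {n : ℕ} (S : Set (FlagSeq F n)) (m : ℕ) : Set (Submodule F (Fin n → F)) :=
  {U | ∃ hm : 1 ≤ m ∧ m ≤ n - 1, ∃ fl ∈ S, fl ⟨m, hm⟩ = U}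

/-! ### Primitive polynomials and companion matrices -/

/-- A primitive polynomial over the finite field `F` with `q` elements, in the sense of finite
fields: a monic irreducible polynomial of degree `d` one of whose roots (equivalently, each of
whose roots) in `F[x]/(f)` generates the multiplicative group, i.e. has order `q ^ d - 1`. -/
def IsPrimitivePoly [Fintype F] (f : F[X]) : Prop :=
  f.Monic ∧ Irreducible f ∧
    orderOf (AdjoinRoot.root f) = Fintype.card F ^ f.natDegree - 1

/-- The unit row with a `1` in position `j` (rows and columns are counted from `0`). -/
def unitRow (j : ℕ) : ℕ → F := Pi.single j 1

/-- Row `r` of the companion matrix of a monic polynomial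
`f = x^d + a_{d-1} x^{d-1} + ... + a_0`: the unit row `r + 1` if `r < d - 1`, and
`(-a_0, ..., -a_{d-1})` if `r = d - 1`. -/
def companionRow (d : ℕ) (f : F[X]) (r : ℕ) : ℕ → F :=
  if r + 1 < d then unitRow (r + 1) else fun c => -f.coeff c

/-! ### The matrices of the construction

Columns are grouped in three blocks of widths `(s - i - 1) k`, `k` and `i k + h`, where
`1 ≤ i ≤ s - 1`; these add up to `n = s k + h`. -/

/-- The row `[x | y | z]` whose first two blocks have widths `o` and `k`. -/
def blockRow (o k : ℕ) (x y z : ℕ → F) : ℕ → F := fun c =>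
  if c < o then x c else if c < o + k then y (c - o) else z (c - o - k)

/-- The block diagonal matrix `diag (I, I, P)` with blocks of orders `(s - i - 1) k`, `k`,
`i k + h`, where `P` is the companion matrix of `f`. -/
def genMatrix (s k h i : ℕ) (f : F[X]) : Matrix (Fin (s * k + h)) (Fin (s * k + h)) F :=
  Matrix.of fun r c =>
    let o := (s - i - 1) * k
    let row : ℕ → F :=
      if (r : ℕ) < o then blockRow o k (unitRow r) 0 0
      else if (r : ℕ) < o + k then blockRow o k 0 (unitRow (r - o)) 0
      else blockRow o k 0 0 (companionRow (i * k + h) f (r - o - k))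
    row c

/-- The cyclic subgroup `G_i` of `GL_n(F)` generated by `diag (I, I, P)`. -/
def groupG (s k h i : ℕ) (f : F[X]) : Subgroup (Matrix.GeneralLinearGroup (Fin (s * k + h)) F) :=
  Subgroup.closure {g | (g : Matrix (Fin (s * k + h)) (Fin (s * k + h)) F) = genMatrix s k h i f}

/-- The matrix `A_i`, with the block rows
`[0 | I_k | first k rows of I]`, `[0 | 0 | remaining rows of I]`, `[I | 0 | 0]`,
`[0 | 0 | first k - 1 rows of I]`, where the `I` in the last column block has order `i k + h`. -/
def matA (F : Type*) [Field F] (s k h i : ℕ) :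
    Matrix (Fin (s * k + h - 1)) (Fin (s * k + h)) F :=
  Matrix.of fun r c =>
    let o := (s - i - 1) * k
    let N := i * k + h
    let row : ℕ → F :=
      if (r : ℕ) < k then blockRow o k 0 (unitRow r) (unitRow r)
      else if (r : ℕ) < N then blockRow o k 0 0 (unitRow r)
      else if (r : ℕ) < N + o then blockRow o k (unitRow (r - N)) 0 0
      else blockRow o k 0 0 (unitRow (r - N - o))
    row c

/-- The matrix `B_i`: as `A_i`, but with first block row `[0 | I_k | 0]`. -/
def matB (F : Type*) [Field F] (s k h i : ℕ) :
    Matrix (Fin (s * k + h - 1)) (Fin (s * k + h)) F :=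
  Matrix.of fun r c =>
    let o := (s - i - 1) * k
    let N := i * k + h
    let row : ℕ → F :=
      if (r : ℕ) < k then blockRow o k 0 (unitRow r) 0
      else if (r : ℕ) < N then blockRow o k 0 0 (unitRow r)
      else if (r : ℕ) < N + o then blockRow o k (unitRow (r - N)) 0 0
      else blockRow o k 0 0 (unitRow (r - N - o))
    row c

/-- The matrix `M`, whose rows are the unit vectors `e_n, e_{n-1}, ..., e_2`, in this order. -/
def matM (F : Type*) [Field F] (n : ℕ) : Matrix (Fin (n - 1)) (Fin n) F :=
  Matrix.of fun r c => unitRow (n - 1 - r) (c : ℕ)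

/-! ### The codes -/

/-- The set of matrices `A_i g` (`g ∈ G_i`) and `B_i`, for `1 ≤ i ≤ s - 1`, and `M`. Here `f i`
is the polynomial whose companion matrix is `P_i`. -/
def generatorMatrices (s k h : ℕ) (f : ℕ → F[X]) :
    Set (Matrix (Fin (s * k + h - 1)) (Fin (s * k + h)) F) :=
  {W | (∃ i, 1 ≤ i ∧ i ≤ s - 1 ∧ ∃ g ∈ groupG s k h i (f i),
          W = matA F s k h i * (g : Matrix (Fin (s * k + h)) (Fin (s * k + h)) F)) ∨
       (∃ i, 1 ≤ i ∧ i ≤ s - 1 ∧ W = matB F s k h i) ∨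
       W = matM F (s * k + h)}

/-- The subspace code of the row spaces of the generator matrices. -/
def subspaceCode (s k h : ℕ) (f : ℕ → F[X]) : Set (Submodule F (Fin (s * k + h) → F)) :=
  rowSpace '' generatorMatrices s k h f

/-- The flag code of the flags attached to the generator matrices. -/
def flagCode (s k h : ℕ) (f : ℕ → F[X]) : Set (FlagSeq F (s * k + h)) :=
  flagOf '' generatorMatrices s k h f

end

end FlagCode

/-!
The last column block `F^(ik+h)` is identified with the field `K_i = F[x]/(f_i)` by sending the
unit vectors to the powers of the root (`tailEval`). Then `diag (I, I, P_i)` acts as multiplication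
by the root, and since `f_i` is primitive, `G_i` acts as the whole multiplicative group of `K_i`
(`exists_actsAs_of_mem_groupG`, `exists_mem_groupG_actsAs`). So the generator matrices are
indexed by the pairs `(i, γ)` with `γ ∈ K_i`, where `γ ≠ 0` stands for `A_i g` and `γ = 0` for
`B_i`, and by one more index for `M` (`exists_generator_enumeration`). The number of indices is the
claimed cardinality, so what remains is that distinct indices give distinct spaces.

The hyperplanes spanned by all rows are told apart by their equations: the last coordinate
of the middle block equals the coefficient of `x^(k-1)` in `γ⁻¹ θ` for `A_i g`, with `θ` the field
element in the last block; that coefficient vanishes for `B_i`; the first coordinate vanishes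
for `M`.

For the spaces `U`, `V` of the first `m` rows it has to be shown that the intersection has
dimension at most `m - k`. For `A_i g` and `A_i g'`, the vectors of the intersection satisfy that
`γ⁻¹ θ` and `γ'⁻¹ θ` agree in the first `k` coefficients, and `γ⁻¹ - γ'⁻¹` is invertible, so that
the remaining `m - k` coordinates determine the vector
(`IsCodeMatrix.finrank_inf_add_le_of_ne_zero`). In the other cases there are `k` vectors in one of
the spaces which are independent modulo the other (`finrank_inf_add_le`), mostly since the other
space vanishes on `k` suitable coordinates (`finrank_inf_add_le_of_coord`). For types `i < i'`
these coordinates depend on whether the left block, which is reached when `m = j k + h` with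
`i < j`, takes part (`finrank_inf_add_le_of_lt`). The delicate pair is `B_1` and `B_{s-1}` with
`j = 2`, where `k` coordinates are available only if `s ≥ 5`; it is what excludes `s = 4`. The
bound `2 k` is attained by `A_i` and `B_i`, which differ in their first `k` rows only.
-/

namespace FlagCode

/-! ### Coordinates, dimensions of intersections, and row spaces -/

section LinearAlgebra

variable {F : Type*} [Field F]

/-- The `c`-th coordinate of a vector of `F^n`, for a natural number `c`; it is `0` if `n ≤ c`. -/
def coord (F : Type*) [Field F] (n c : ℕ) : (Fin n → F) →ₗ[F] F :=
  if hc : c < n then LinearMap.proj ⟨c, hc⟩ else 0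

theorem coord_apply {n c : ℕ} (hc : c < n) (v : Fin n → F) : coord F n c v = v ⟨c, hc⟩ := by
  simp [coord, hc]

theorem coord_natFun {n c : ℕ} (hc : c < n) (g : ℕ → F) :
    coord F n c (fun x : Fin n => g x) = g c := by
  simp [coord, hc]

theorem ext_coord {n : ℕ} {v w : Fin n → F} (h : ∀ c < n, coord F n c v = coord F n c w) :
    v = w := by
  ext x
  have := h x x.2
  rwa [coord_apply x.2, coord_apply x.2] at this

/-- The unit vector of `F^n` in position `c`, for a natural number `c`. -/
def stdVec (F : Type*) [Field F] (n c : ℕ) : Fin n → F := fun x => unitRow c (x : ℕ)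

theorem coord_stdVec {n c : ℕ} (hc : c < n) (d : ℕ) :
    coord F n c (stdVec F n d) = if c = d then 1 else 0 := by
  refine (coord_natFun hc (unitRow d)).trans ?_
  rw [unitRow, Pi.single_apply]

/-- If `U` contains `k` vectors no nontrivial combination of which lies in `V`, then the
intersection with `V` has codimension at least `k` in `U`. -/
theorem finrank_inf_add_le {n k : ℕ} {U V : Submodule F (Fin n → F)} (t : Fin k → Fin n → F)
    (ht : ∀ r, t r ∈ U) (hV : ∀ b : Fin k → F, ∑ r, b r • t r ∈ V → b = 0) :
    Module.finrank F ↥(U ⊓ V) + k ≤ Module.finrank F U := by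
  have hli : LinearIndependent F t := by
    rw [Fintype.linearIndependent_iff]
    intro b hb r
    have := hV b (by rw [hb]; exact V.zero_mem)
    simp [this]
  have hT : Module.finrank F (Submodule.span F (Set.range t)) = k := by
    rw [finrank_span_eq_card hli, Fintype.card_fin]
  have hdis : (U ⊓ V) ⊓ Submodule.span F (Set.range t) = ⊥ := by
    rw [eq_bot_iff]
    rintro v ⟨⟨-, hv⟩, hvt⟩
    obtain ⟨b, rfl⟩ := (Submodule.mem_span_range_iff_exists_fun F).1 hvt
    simp [hV b hv]
  have hsum := Submodule.finrank_sup_add_finrank_inf_eq (U ⊓ V) (Submodule.span F (Set.range t))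
  rw [hdis, finrank_bot, hT, add_zero] at hsum
  rw [← hsum]
  apply Submodule.finrank_mono
  refine sup_le inf_le_left ?_
  rw [Submodule.span_le]
  rintro _ ⟨r, rfl⟩
  exact ht r

/-- The special case of `finrank_inf_add_le` in which `V` vanishes on `k` coordinates on which
the chosen vectors of `U` restrict to the unit vectors. -/
theorem finrank_inf_add_le_of_coord {n k : ℕ} {U V : Submodule F (Fin n → F)} (w : ℕ → ℕ)
    (hV : ∀ v ∈ V, ∀ r < k, coord F n (w r) v = 0)
    (hU : ∀ r < k, ∃ t ∈ U, ∀ r' < k, coord F n (w r') t = if r' = r then 1 else 0) :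
    Module.finrank F ↥(U ⊓ V) + k ≤ Module.finrank F U := by
  choose t ht htc using fun r : Fin k => hU r r.2
  refine finrank_inf_add_le t ht fun b hb => ?_
  ext r
  have := hV _ hb r r.2
  simpa [htc _ r r.2, Fin.val_inj] using this

theorem finrank_le_of_injOn {n d : ℕ} {P : Submodule F (Fin n → F)}
    (L : (Fin n → F) →ₗ[F] (Fin d → F)) (hL : ∀ v ∈ P, L v = 0 → v = 0) :
    Module.finrank F P ≤ d := by
  have hinj : Function.Injective (L.domRestrict P) := by
    rw [← LinearMap.ker_eq_bot, LinearMap.ker_eq_bot']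
    rintro ⟨v, hv⟩ h
    exact Subtype.ext (hL v hv h)
  simpa using LinearMap.finrank_le_finrank_of_injective hinj

theorem row_mem_rowSpace_firstRows {l n m : ℕ} (W : Matrix (Fin l) (Fin n) F) (r : Fin l)
    (hr : (r : ℕ) < m) : W r ∈ rowSpace (firstRows W m) :=
  Submodule.subset_span ⟨⟨r, hr⟩, rfl⟩

theorem eq_zero_of_mem_rowSpace_firstRows {E : Type*} [AddCommGroup E] [Module F E] {l n m : ℕ}
    {W : Matrix (Fin l) (Fin n) F} (L : (Fin n → F) →ₗ[F] E)
    (hL : ∀ r : Fin l, (r : ℕ) < m → L (W r) = 0) {v : Fin n → F}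
    (hv : v ∈ rowSpace (firstRows W m)) : L v = 0 := by
  have : rowSpace (firstRows W m) ≤ LinearMap.ker L := by
    rw [rowSpace, Submodule.span_le]
    rintro _ ⟨⟨r, hr⟩, rfl⟩
    exact hL r hr
  exact this hv

/-- The first `m` rows span a space of dimension `m` as soon as there are linear functionals dual
to them. -/
theorem finrank_rowSpace_firstRows {l n m : ℕ} (hm : m ≤ l) (W : Matrix (Fin l) (Fin n) F)
    (D : ℕ → (Fin n → F) →ₗ[F] F)
    (hD : ∀ r < m, ∀ r' : Fin l, (r' : ℕ) < m → D r (W r') = if r = (r' : ℕ) then 1 else 0) :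
    Module.finrank F (rowSpace (firstRows W m)) = m := by
  have hli : LinearIndependent F (firstRows W m).row := by
    rw [linearIndependent_iff']
    intro S b hb r hr
    have := congrArg (D (r.1 : ℕ)) hb
    rw [map_sum, map_zero, Finset.sum_eq_single r] at this
    · rw [map_smul, show (firstRows W m).row r = W r.1 from rfl, hD _ r.2 _ r.2] at this
      simpa using this
    · intro r' _ hne
      rw [map_smul, show (firstRows W m).row r' = W r'.1 from rfl, hD _ r.2 _ r'.2, if_neg,
        smul_zero]
      exact fun h => hne (Subtype.ext (Fin.ext h.symm))
    · exact fun h => absurd hr h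
  rw [rowSpace, finrank_span_eq_card hli, Fintype.card_subtype]
  have : (Finset.univ.filter fun r : Fin l => (r : ℕ) < m).card = (Finset.range m).card := by
    refine Finset.card_bij (fun r _ => (r : ℕ)) (by simp) (fun a _ b _ h => Fin.ext h) ?_
    intro b hb
    rw [Finset.mem_range] at hb
    exact ⟨⟨b, by omega⟩, by simpa using hb, rfl⟩
  rw [this, Finset.card_range]

theorem subspaceDist_add {n m : ℕ} {U V : Submodule F (Fin n → F)}
    (hU : Module.finrank F U = m) (hV : Module.finrank F V = m) :
    subspaceDist U V + 2 * Module.finrank F ↥(U ⊓ V) = 2 * m := by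
  have h1 := Submodule.finrank_sup_add_finrank_inf_eq U V
  have h2 : Module.finrank F ↥(U ⊓ V) ≤ Module.finrank F U :=
    Submodule.finrank_mono inf_le_left
  rw [subspaceDist]
  omega

end LinearAlgebra

/-! ### Coordinates in `F[x]/(f)` -/

section Root

variable {F : Type*} [Field F] {f : F[X]}

/-- The coefficient of `x^c` in the reduced representative of an element of `F[x]/(f)`. -/
noncomputable def rootCoeff (hf : f.Monic) (c : ℕ) : AdjoinRoot f →ₗ[F] F :=
  (Polynomial.lcoeff F c).comp (AdjoinRoot.modByMonicHom hf)

theorem rootCoeff_root_pow (hf : f.Monic) {r : ℕ} (hr : r < f.natDegree) (c : ℕ) :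
    rootCoeff hf c (AdjoinRoot.root f ^ r) = if c = r then 1 else 0 := by
  have h : AdjoinRoot.root f ^ r = AdjoinRoot.mk f (Polynomial.X ^ r) := by
    rw [map_pow, AdjoinRoot.mk_X]
  rw [rootCoeff, LinearMap.comp_apply, h, AdjoinRoot.modByMonicHom_mk,
    (Polynomial.modByMonic_eq_self_iff hf).2, Polynomial.lcoeff_apply, Polynomial.coeff_X_pow]
  rw [Polynomial.degree_X_pow, Polynomial.degree_eq_natDegree hf.ne_zero]
  exact_mod_cast hr

theorem rootCoeff_sum (hf : f.Monic) {N c : ℕ} (hN : f.natDegree = N) (hc : c < N) (z : ℕ → F) :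
    rootCoeff hf c (∑ r ∈ Finset.range N, z r • AdjoinRoot.root f ^ r) = z c := by
  rw [map_sum, Finset.sum_eq_single c]
  · rw [map_smul, rootCoeff_root_pow hf (hN ▸ hc), if_pos rfl, smul_eq_mul, mul_one]
  · intro r hr hne
    rw [Finset.mem_range] at hr
    rw [map_smul, rootCoeff_root_pow hf (hN ▸ hr), if_neg hne.symm, smul_zero]
  · simp [hc]

theorem sum_rootCoeff (hf : f.Monic) {N : ℕ} (hN : f.natDegree = N) (w : AdjoinRoot f) :
    ∑ c ∈ Finset.range N, rootCoeff hf c w • AdjoinRoot.root f ^ c = w := by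
  rcases eq_or_ne N 0 with h0 | h0
  · have h1 : f = 1 := hf.natDegree_eq_zero.1 (hN.trans h0)
    have : Subsingleton (AdjoinRoot f) := by
      rw [h1]
      exact Ideal.Quotient.subsingleton_iff.2 (by simp)
    exact Subsingleton.elim _ _
  induction w using AdjoinRoot.induction_on with
  | ih p =>
    have hp : AdjoinRoot.mk f p = AdjoinRoot.mk f (p %ₘ f) := by
      conv_lhs => rw [← Polynomial.modByMonic_add_div p f]
      simp
    have hd : (p %ₘ f).natDegree < N := by
      rw [← hN]
      exact Polynomial.natDegree_modByMonic_lt p hf (by rintro rfl; simp at hN; omega)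
    conv_rhs => rw [hp, Polynomial.as_sum_range' _ _ hd]
    rw [map_sum]
    refine Finset.sum_congr rfl fun c _ => ?_
    rw [rootCoeff, LinearMap.comp_apply, AdjoinRoot.modByMonicHom_mk, Polynomial.lcoeff_apply,
      ← Polynomial.C_mul_X_pow_eq_monomial, map_mul, map_pow, AdjoinRoot.mk_X, AdjoinRoot.mk_C,
      Algebra.smul_def]
    rfl

theorem eq_zero_of_rootCoeff (hf : f.Monic) {N : ℕ} (hN : f.natDegree = N) {w : AdjoinRoot f}
    (h : ∀ c < N, rootCoeff hf c w = 0) : w = 0 := by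
  rw [← sum_rootCoeff hf hN w]
  refine Finset.sum_eq_zero fun c hc => ?_
  rw [h c (Finset.mem_range.1 hc), zero_smul]

/-- The coordinates `a, ..., a + N - 1` of a vector, read as an element of `F[x]/(f)`. -/
noncomputable def tailEval (n a N : ℕ) (f : F[X]) : (Fin n → F) →ₗ[F] AdjoinRoot f :=
  ∑ c ∈ Finset.range N, (coord F n (a + c)).smulRight (AdjoinRoot.root f ^ c)

theorem tailEval_apply (n a N : ℕ) (v : Fin n → F) :
    tailEval n a N f v =
      ∑ c ∈ Finset.range N, coord F n (a + c) v • AdjoinRoot.root f ^ c := by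
  simp [tailEval]

theorem rootCoeff_tailEval (hf : f.Monic) {n a N c : ℕ} (hN : f.natDegree = N) (hc : c < N)
    (v : Fin n → F) : rootCoeff hf c (tailEval n a N f v) = coord F n (a + c) v := by
  rw [tailEval_apply, rootCoeff_sum hf hN hc fun c => coord F n (a + c) v]

theorem tailEval_eq_zero {n a N : ℕ} {v : Fin n → F}
    (h : ∀ c < N, coord F n (a + c) v = 0) : tailEval n a N f v = 0 := by
  rw [tailEval_apply]
  refine Finset.sum_eq_zero fun c hc => ?_
  rw [h c (Finset.mem_range.1 hc), zero_smul]

theorem tailEval_of_coord {n a N r : ℕ} {v : Fin n → F} (hr : r < N)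
    (h : ∀ c < N, coord F n (a + c) v = if c = r then 1 else 0) :
    tailEval n a N f v = AdjoinRoot.root f ^ r := by
  rw [tailEval_apply, Finset.sum_eq_single r]
  · rw [h r hr, if_pos rfl, one_smul]
  · intro c hc hne
    rw [h c (Finset.mem_range.1 hc), if_neg hne, zero_smul]
  · simp [hr]

end Root

/-! ### Matrices described by their coordinates -/

section CodeMatrix

variable {F : Type*} [Field F] {f : F[X]} {n o k N m : ℕ}

/-- A description, by coordinates, of the matrices `A_i g` and `B_i`. The first `o` columns, the
next `k` and the last `N` form the three column blocks, and the last block of a row is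
read in `F[x]/(f)`, where `g` acts as multiplication by some `γ ≠ 0`. The value `γ = 0` stands
for `B_i`. -/
structure IsCodeMatrix (o k N : ℕ) (γ : AdjoinRoot f) (W : Matrix (Fin (n - 1)) (Fin n) F) :
    Prop where
  coord_left : ∀ r c, c < o → coord F n c (W r) = if (r : ℕ) = N + c then 1 else 0
  coord_mid : ∀ r c, c < k → coord F n (o + c) (W r) = if (r : ℕ) = c then 1 else 0
  tail_of_ne : γ ≠ 0 → ∀ r, tailEval n (o + k) N f (W r) =
    γ * if (r : ℕ) < N then AdjoinRoot.root f ^ (r : ℕ)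
      else if (r : ℕ) < N + o then 0 else AdjoinRoot.root f ^ ((r : ℕ) - N - o)
  tail_of_eq : γ = 0 → ∀ r c, c < N → coord F n (o + k + c) (W r) =
    if (k ≤ c ∧ (r : ℕ) = c) ∨ (r : ℕ) = N + o + c then 1 else 0

theorem ext_coord_blocks (hn : o + k + N = n) {v w : Fin n → F}
    (h1 : ∀ c < o, coord F n c v = coord F n c w)
    (h2 : ∀ c < k, coord F n (o + c) v = coord F n (o + c) w)
    (h3 : ∀ c < N, coord F n (o + k + c) v = coord F n (o + k + c) w) : v = w := by
  refine ext_coord fun c hc => ?_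
  by_cases ho : c < o
  · exact h1 c ho
  by_cases hk : c < o + k
  · obtain ⟨d, rfl⟩ := Nat.exists_eq_add_of_le (not_lt.1 ho)
    exact h2 d (by omega)
  · obtain ⟨d, rfl⟩ := Nat.exists_eq_add_of_le (not_lt.1 hk)
    exact h3 d (by omega)

namespace IsCodeMatrix

variable {γ : AdjoinRoot f} {W : Matrix (Fin (n - 1)) (Fin n) F}

theorem coord_left_eq_zero (H : IsCodeMatrix o k N γ W) {c : ℕ} (hc : c < o) (hm : m ≤ N + c)
    {v : Fin n → F} (hv : v ∈ rowSpace (firstRows W m)) : coord F n c v = 0 := by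
  refine eq_zero_of_mem_rowSpace_firstRows _ (fun r hr => ?_) hv
  rw [H.coord_left r c hc, if_neg (by omega)]

theorem exists_coord_mid (H : IsCodeMatrix o k N γ W) (hk : k ≤ m) (hm : m ≤ n - 1) {r : ℕ}
    (hr : r < k) : ∃ t ∈ rowSpace (firstRows W m),
      ∀ r' < k, coord F n (o + r') t = if r' = r then 1 else 0 := by
  refine ⟨W ⟨r, by omega⟩, row_mem_rowSpace_firstRows W _ (by simp; omega), fun r' hr' => ?_⟩
  rw [H.coord_mid _ _ hr']
  simp [eq_comm]

theorem stdVec_mid_mem (H : IsCodeMatrix o k N γ W) (hn : o + k + N = n) (hkN : k ≤ N)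
    (h0 : γ = 0) (hm : m ≤ n - 1) {r : ℕ} (hr : r < k) (hrm : r < m) :
    stdVec F n (o + r) ∈ rowSpace (firstRows W m) := by
  have : W ⟨r, by omega⟩ = stdVec F n (o + r) := by
    refine ext_coord_blocks hn (fun c hc => ?_) (fun c hc => ?_) fun c hc => ?_
    · rw [H.coord_left _ _ hc, coord_stdVec (by omega), if_neg (by simp; omega),
        if_neg (by omega)]
    · rw [H.coord_mid _ _ hc, coord_stdVec (by omega)]
      simp [eq_comm]
    · rw [H.tail_of_eq h0 _ _ hc, coord_stdVec (by omega), if_neg (by simp; omega),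
        if_neg (by omega)]
  rw [← this]
  exact row_mem_rowSpace_firstRows W _ hrm

theorem coord_tail_eq_zero (H : IsCodeMatrix o k N γ W) (h0 : γ = 0) (hm : m ≤ N + o) {c : ℕ}
    (hc : c < N) (hcm : c < k ∨ m ≤ c) {v : Fin n → F}
    (hv : v ∈ rowSpace (firstRows W m)) : coord F n (o + k + c) v = 0 := by
  refine eq_zero_of_mem_rowSpace_firstRows _ (fun r hr => ?_) hv
  rw [H.tail_of_eq h0 _ _ hc, if_neg (by omega)]

variable [Fact (Irreducible f)]

theorem stdVec_left_mem (H : IsCodeMatrix o k N γ W) (hn : o + k + N = n) (hf : f.Monic)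
    (hN : f.natDegree = N) (hkN : k ≤ N) (hm : m ≤ n - 1) {c : ℕ} (hc : c < o)
    (hcm : N + c < m) : stdVec F n c ∈ rowSpace (firstRows W m) := by
  have : W ⟨N + c, by omega⟩ = stdVec F n c := by
    refine ext_coord_blocks hn (fun d hd => ?_) (fun d hd => ?_) fun d hd => ?_
    · rw [H.coord_left _ _ hd, coord_stdVec (by omega)]
      simp [eq_comm]
    · rw [H.coord_mid _ _ hd, coord_stdVec (by omega), if_neg (by simp; omega),
        if_neg (by omega)]
    · rw [coord_stdVec (by omega), if_neg (by omega)]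
      by_cases h0 : γ = 0
      · rw [H.tail_of_eq h0 _ _ hd, if_neg (by simp; omega)]
      · rw [← rootCoeff_tailEval hf hN hd, H.tail_of_ne h0, if_neg (by simp),
          if_pos (by simp; omega), mul_zero, map_zero]
  rw [← this]
  exact row_mem_rowSpace_firstRows W _ hcm

/-- The rows that `A_i` and `B_i` have in common. -/
theorem stdVec_tail_mem (H : IsCodeMatrix o k N γ W) (hn : o + k + N = n) (hf : f.Monic)
    (hN : f.natDegree = N) (h01 : γ = 0 ∨ γ = 1) (hm : m ≤ n - 1) {r : ℕ}
    (hr : r < N) (hkr : k ≤ r) (hrm : r < m) :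
    stdVec F n (o + k + r) ∈ rowSpace (firstRows W m) := by
  have : W ⟨r, by omega⟩ = stdVec F n (o + k + r) := by
    refine ext_coord_blocks hn (fun d hd => ?_) (fun d hd => ?_) fun d hd => ?_
    · rw [H.coord_left _ _ hd, coord_stdVec (by omega), if_neg (by simp; omega),
        if_neg (by omega)]
    · rw [H.coord_mid _ _ hd, coord_stdVec (by omega), if_neg (by simp; omega),
        if_neg (by omega)]
    · rw [coord_stdVec (by omega)]
      rcases h01 with h0 | h1
      · rw [H.tail_of_eq h0 _ _ hd]
        refine if_congr ?_ rfl rfl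
        simp only
        omega
      · rw [← rootCoeff_tailEval hf hN hd, H.tail_of_ne (by rw [h1]; exact one_ne_zero),
          if_pos hr, h1, one_mul, rootCoeff_root_pow hf (hN ▸ hr)]
        simp
  rw [← this]
  exact row_mem_rowSpace_firstRows W _ hrm

/-- The functionals dual to the first `N` rows of `A_i g`. -/
theorem rootCoeff_row (H : IsCodeMatrix o k N γ W) (hf : f.Monic) (hN : f.natDegree = N)
    (h0 : γ ≠ 0) {c : ℕ} {r : Fin (n - 1)} (hc : c < N) (hr : (r : ℕ) < N + o) :
    rootCoeff hf c (γ⁻¹ * tailEval n (o + k) N f (W r)) = if c = (r : ℕ) then 1 else 0 := by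
  rw [H.tail_of_ne h0, inv_mul_cancel_left₀ h0]
  by_cases hrN : (r : ℕ) < N
  · rw [if_pos hrN, rootCoeff_root_pow hf (hN ▸ hrN)]
  · rw [if_neg hrN, if_pos hr, map_zero, if_neg (by omega)]

theorem coord_mid_eq_rootCoeff (H : IsCodeMatrix o k N γ W) (hf : f.Monic)
    (hN : f.natDegree = N) (hkN : k ≤ N) (h0 : γ ≠ 0) (hm : m ≤ N + o) {c : ℕ} (hc : c < k)
    {v : Fin n → F} (hv : v ∈ rowSpace (firstRows W m)) :
    coord F n (o + c) v = rootCoeff hf c (γ⁻¹ * tailEval n (o + k) N f v) := by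
  rw [← sub_eq_zero]
  refine eq_zero_of_mem_rowSpace_firstRows
    (coord F n (o + c) - rootCoeff hf c ∘ₗ LinearMap.mulLeft F γ⁻¹ ∘ₗ tailEval n (o + k) N f)
    (fun r hr => ?_) hv
  simp only [LinearMap.sub_apply, LinearMap.comp_apply, LinearMap.mulLeft_apply]
  rw [H.rootCoeff_row hf hN h0 (by omega) (by omega), H.coord_mid _ _ hc, sub_eq_zero]
  simp [eq_comm]

theorem rootCoeff_eq_zero (H : IsCodeMatrix o k N γ W) (hf : f.Monic) (hN : f.natDegree = N)
    (h0 : γ ≠ 0) (hm : m ≤ N + o) {c : ℕ} (hc : c < N) (hcm : m ≤ c)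
    {v : Fin n → F} (hv : v ∈ rowSpace (firstRows W m)) :
    rootCoeff hf c (γ⁻¹ * tailEval n (o + k) N f v) = 0 := by
  refine eq_zero_of_mem_rowSpace_firstRows
    (rootCoeff hf c ∘ₗ LinearMap.mulLeft F γ⁻¹ ∘ₗ tailEval n (o + k) N f) (fun r hr => ?_) hv
  simp only [LinearMap.comp_apply, LinearMap.mulLeft_apply]
  rw [H.rootCoeff_row hf hN h0 hc (by omega), if_neg (by omega)]

theorem coord_mid_eq_zero (H : IsCodeMatrix o k N γ W) (hf : f.Monic) (hN : f.natDegree = N)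
    (hkN : k ≤ N) (h0 : γ ≠ 0) (hm : m ≤ N + o) {c : ℕ} (hc : c < k)
    {v : Fin n → F} (hv : v ∈ rowSpace (firstRows W m))
    (hθ : tailEval n (o + k) N f v = 0) : coord F n (o + c) v = 0 := by
  rw [H.coord_mid_eq_rootCoeff hf hN hkN h0 hm hc hv, hθ, mul_zero, map_zero]

theorem exists_tailEval_eq (H : IsCodeMatrix o k N γ W) (hf : f.Monic) (hN : f.natDegree = N)
    (h0 : γ ≠ 0) (hNm : N ≤ m) (hm : m ≤ n - 1) (w : AdjoinRoot f) :
    ∃ t ∈ rowSpace (firstRows W m), tailEval n (o + k) N f t = w := by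
  refine ⟨∑ r : Fin N, rootCoeff hf r (γ⁻¹ * w) • W ⟨r, by omega⟩,
    Submodule.sum_mem _ fun r _ => Submodule.smul_mem _ _
      (row_mem_rowSpace_firstRows W _ (by simp; omega)), ?_⟩
  have hw : w = γ * ∑ r : Fin N, rootCoeff hf r (γ⁻¹ * w) • AdjoinRoot.root f ^ (r : ℕ) := by
    rw [← Finset.sum_range fun r => rootCoeff hf r (γ⁻¹ * w) • AdjoinRoot.root f ^ r,
      sum_rootCoeff hf hN, mul_inv_cancel_left₀ h0]
  rw [map_sum]
  conv_rhs => rw [hw, Finset.mul_sum]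
  refine Finset.sum_congr rfl fun r _ => ?_
  rw [map_smul, H.tail_of_ne h0, if_pos r.2, mul_smul_comm]

theorem finrank_rowSpace (H : IsCodeMatrix o k N γ W) (hn : o + k + N = n) (hf : f.Monic)
    (hN : f.natDegree = N) (hm : m ≤ N + o) (hm' : m ≤ n - 1) :
    Module.finrank F (rowSpace (firstRows W m)) = m := by
  by_cases h0 : γ = 0
  · refine FlagCode.finrank_rowSpace_firstRows hm' W
      (fun r => if r < k then coord F n (o + r) else if r < N then coord F n (o + k + r)
        else coord F n (r - N)) fun r hr r' hr' => ?_
    by_cases h1 : r < k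
    · rw [if_pos h1, H.coord_mid _ _ h1]
      exact if_congr eq_comm rfl rfl
    by_cases h2 : r < N
    · rw [if_neg h1, if_pos h2, H.tail_of_eq h0 _ _ h2]
      exact if_congr (by omega) rfl rfl
    · rw [if_neg h1, if_neg h2, H.coord_left _ _ (by omega)]
      exact if_congr (by omega) rfl rfl
  · refine FlagCode.finrank_rowSpace_firstRows hm' W
      (fun r => if r < N then
          rootCoeff hf r ∘ₗ LinearMap.mulLeft F γ⁻¹ ∘ₗ tailEval n (o + k) N f
        else coord F n (r - N)) fun r hr r' hr' => ?_
    by_cases h1 : r < N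
    · rw [if_pos h1, LinearMap.comp_apply, LinearMap.comp_apply, LinearMap.mulLeft_apply,
        H.rootCoeff_row hf hN h0 h1 (by omega)]
    · rw [if_neg h1, H.coord_left _ _ (by omega)]
      refine if_congr ?_ rfl rfl
      omega

/-- The spaces of `A_i g` and `A_i g'`: the intersection embeds in `F^(m - k)`, since a vector
of it has coordinates `a`, `a'` in the two bases of rows which agree in the first `k` places,
and is determined by `a - a'` together with its left block. -/
theorem finrank_inf_add_le_of_ne_zero {γ' : AdjoinRoot f} {W' : Matrix (Fin (n - 1)) (Fin n) F}
    (H : IsCodeMatrix o k N γ W) (H' : IsCodeMatrix o k N γ' W') (hn : o + k + N = n)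
    (hf : f.Monic) (hN : f.natDegree = N) (hkN : k ≤ N) (hk : k ≤ m) (hm : m ≤ N + o)
    (h0 : γ ≠ 0) (h0' : γ' ≠ 0) (hne : γ ≠ γ') :
    Module.finrank F ↥(rowSpace (firstRows W m) ⊓ rowSpace (firstRows W' m)) + k ≤ m := by
  have hδ : γ⁻¹ - γ'⁻¹ ≠ 0 := sub_ne_zero.2 fun h => hne (inv_injective h)
  suffices Module.finrank F ↥(rowSpace (firstRows W m) ⊓ rowSpace (firstRows W' m)) ≤ m - k by
    omega
  refine finrank_le_of_injOn (LinearMap.pi fun r : Fin (m - k) => if k + r < N then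
      rootCoeff hf (k + r) ∘ₗ LinearMap.mulLeft F (γ⁻¹ - γ'⁻¹) ∘ₗ tailEval n (o + k) N f
    else coord F n (k + r - N)) ?_
  rintro v ⟨hv, hv'⟩ hL
  have hL' : ∀ c, k ≤ c → c < m → (if c < N then
      rootCoeff hf c ∘ₗ LinearMap.mulLeft F (γ⁻¹ - γ'⁻¹) ∘ₗ tailEval n (o + k) N f
    else coord F n (c - N)) v = 0 := by
    intro c hc hcm
    obtain ⟨d, rfl⟩ := Nat.exists_eq_add_of_le hc
    exact congrFun hL ⟨d, by omega⟩
  have hθ : tailEval n (o + k) N f v = 0 := by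
    refine (mul_eq_zero.1 (eq_zero_of_rootCoeff hf hN (w := (γ⁻¹ - γ'⁻¹) * _)
      fun c hc => ?_)).resolve_left hδ
    by_cases hck : c < k
    · rw [sub_mul, map_sub, ← H.coord_mid_eq_rootCoeff hf hN hkN h0 hm hck hv,
        ← H'.coord_mid_eq_rootCoeff hf hN hkN h0' hm hck hv', sub_self]
    by_cases hcm : c < m
    · have := hL' c (by omega) hcm
      rwa [if_pos hc] at this
    · rw [sub_mul, map_sub, H.rootCoeff_eq_zero hf hN h0 hm hc (by omega) hv,
        H'.rootCoeff_eq_zero hf hN h0' hm hc (by omega) hv', sub_self]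
  refine ext_coord_blocks hn (fun c hc => ?_) (fun c hc => ?_) fun c hc => ?_
  · rw [map_zero]
    by_cases hcm : N + c < m
    · have := hL' (N + c) (by omega) hcm
      rwa [if_neg (by omega), Nat.add_sub_cancel_left] at this
    · exact H.coord_left_eq_zero hc (by omega) hv
  · rw [map_zero, H.coord_mid_eq_zero hf hN hkN h0 hm hc hv hθ]
  · rw [map_zero, ← rootCoeff_tailEval hf hN hc, hθ, map_zero]

/-- A space `U` containing the unit vectors of the middle column block, against that of `A_i g`:
a vector of the latter vanishes in the middle block if its last block vanishes. -/
theorem finrank_inf_add_le_of_stdVec_mem (H : IsCodeMatrix o k N γ W) (hn : o + k + N = n)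
    (hf : f.Monic) (hN : f.natDegree = N) (hkN : k ≤ N) (hm : m ≤ N + o) (h0 : γ ≠ 0)
    {U : Submodule F (Fin n → F)} (hU : ∀ r < k, stdVec F n (o + r) ∈ U) :
    Module.finrank F ↥(U ⊓ rowSpace (firstRows W m)) + k ≤ Module.finrank F U := by
  refine finrank_inf_add_le (fun r : Fin k => stdVec F n (o + r)) (fun r => hU r r.2)
    fun b hb => ?_
  have hc : ∀ c < n, coord F n c (∑ r : Fin k, b r • stdVec F n (o + r)) =
      ∑ r : Fin k, b r * if c = o + r then 1 else 0 := by
    intro c hc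
    simp only [map_sum, map_smul, coord_stdVec hc, smul_eq_mul]
  have hθ : tailEval n (o + k) N f (∑ r : Fin k, b r • stdVec F n (o + r)) = 0 := by
    refine tailEval_eq_zero fun c hcN => ?_
    rw [hc _ (by omega)]
    refine Finset.sum_eq_zero fun r _ => ?_
    rw [if_neg (by omega), mul_zero]
  ext r
  have := H.coord_mid_eq_zero hf hN hkN h0 hm r.2 hb hθ
  rw [hc _ (by omega), Finset.sum_eq_single r] at this
  · simpa using this
  · intro r' _ hne
    rw [if_neg, mul_zero]
    intro h
    exact hne (Fin.ext (by omega))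
  · simp

theorem finrank_inf_add_le_of_eq_zero {γ' : AdjoinRoot f} {W' : Matrix (Fin (n - 1)) (Fin n) F}
    (H : IsCodeMatrix o k N γ W) (H' : IsCodeMatrix o k N γ' W') (hn : o + k + N = n)
    (hf : f.Monic) (hN : f.natDegree = N) (hkN : k ≤ N) (hk : k ≤ m) (hm : m ≤ N + o)
    (hm' : m ≤ n - 1) (h0 : γ = 0) (h0' : γ' ≠ 0) :
    Module.finrank F ↥(rowSpace (firstRows W m) ⊓ rowSpace (firstRows W' m)) + k ≤ m := by
  conv_rhs => rw [← H.finrank_rowSpace hn hf hN hm hm']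
  exact H'.finrank_inf_add_le_of_stdVec_mem hn hf hN hkN hm h0'
    fun r hr => H.stdVec_mid_mem hn hkN h0 hm' hr (by omega)

end IsCodeMatrix

end CodeMatrix

/-! ### Intersections for different column blocks -/

section Distance

variable {F : Type*} [Field F] {f f' : F[X]} {n o o' k N N' m : ℕ}
  {γ : AdjoinRoot f} {γ' : AdjoinRoot f'} {W W' : Matrix (Fin (n - 1)) (Fin n) F}

namespace IsCodeMatrix

/-- If the left block of `W` is not reached within `m` rows, then the space of `W` vanishes on
the middle block of `W'`. -/
theorem finrank_inf_add_le_of_le (H : IsCodeMatrix o k N γ W) (H' : IsCodeMatrix o' k N' γ' W')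
    (ho : o' + k ≤ o) (hk : k ≤ m) (hm : m ≤ n - 1) (hmN : m ≤ N) :
    Module.finrank F ↥(rowSpace (firstRows W' m) ⊓ rowSpace (firstRows W m)) + k ≤
      Module.finrank F (rowSpace (firstRows W' m)) :=
  finrank_inf_add_le_of_coord (fun r => o' + r)
    (fun _ hv _ hr => H.coord_left_eq_zero (by omega) (by omega) hv)
    fun _ hr => H'.exists_coord_mid hk hm hr

variable [Fact (Irreducible f)]

/-- The left block of `W`, as far as it is reached within `m` rows, exceeds that of `W'` by at
least `k` coordinates, on which `W'` vanishes. -/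
theorem finrank_inf_add_le_of_left (H : IsCodeMatrix o k N γ W)
    (H' : IsCodeMatrix o' k N' γ' W') (hn : o + k + N = n) (hn' : o' + k + N' = n)
    (hf : f.Monic) (hN : f.natDegree = N) (hkN : k ≤ N) (hm : m ≤ n - 1) (hNN : N + k ≤ N')
    (hNm : N + k ≤ m) (ho : m - N' + k ≤ o') :
    Module.finrank F ↥(rowSpace (firstRows W m) ⊓ rowSpace (firstRows W' m)) + k ≤
      Module.finrank F (rowSpace (firstRows W m)) := by
  refine finrank_inf_add_le_of_coord (fun r => m - N' + r)
    (fun _ hv _ hr => H'.coord_left_eq_zero (by omega) (by omega) hv) fun r hr =>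
      ⟨_, H.stdVec_left_mem hn hf hN hkN hm (c := m - N' + r) (by omega) (by omega),
        fun r' hr' => ?_⟩
  rw [coord_stdVec (by omega)]
  simp

variable [Fact (Irreducible f')]

/-- The case in which `W'` has no left block. If `W'` comes from some `A_i g`, then the first `k`
unit vectors are compared with it. If it comes from some `B_i`, its space vanishes on the
coordinates from `k` to `2 k - 1` and on those from `k + m` on, and `k` of these are free in
the space of `W`. The last alternative of `hcase` is the one that fails for `s = 4`. -/
theorem finrank_inf_add_le_of_last (H : IsCodeMatrix o k N γ W)
    (H' : IsCodeMatrix 0 k N' γ' W') (hn : o + k + N = n) (hn' : 0 + k + N' = n)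
    (hf : f.Monic) (hN : f.natDegree = N) (hkN : k ≤ N)
    (hf' : f'.Monic) (hN' : f'.natDegree = N') (hm : m ≤ n - 1) (hmn : m + 2 * k ≤ n)
    (hNm : N + k ≤ m)
    (hcase : N + 2 * k ≤ m ∨ 2 * k ≤ N ∨ ∃ h < k, N = k + h ∧ m = 2 * k + h ∧ 5 * k + h ≤ n) :
    Module.finrank F ↥(rowSpace (firstRows W m) ⊓ rowSpace (firstRows W' m)) + k ≤
      Module.finrank F (rowSpace (firstRows W m)) := by
  by_cases h0' : γ' ≠ 0
  · refine H'.finrank_inf_add_le_of_stdVec_mem hn' hf' hN' (by omega) (by omega) h0' fun r hr => ?_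
    exact H.stdVec_left_mem hn hf hN hkN hm (by omega) (by omega)
  rw [not_not] at h0'
  have hV : ∀ v ∈ rowSpace (firstRows W' m), ∀ c, k ≤ c → c < n → c < 2 * k ∨ k + m ≤ c →
      coord F n c v = 0 := by
    intro v hv c hkc hcn hc
    obtain ⟨d, rfl⟩ := Nat.exists_eq_add_of_le hkc
    have := H'.coord_tail_eq_zero h0' (by omega) (c := d) (by omega) (by omega) hv
    rwa [zero_add] at this
  by_cases h0 : γ ≠ 0
  -- All `N` first rows are present, so the last block takes every value.
  · refine finrank_inf_add_le_of_coord (fun r => o + k + (N - k + r))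
      (fun v hv r hr => hV v hv _ (by omega) (by omega) (by omega)) fun r hr => ?_
    obtain ⟨t, ht, hθ⟩ := H.exists_tailEval_eq hf hN h0 (m := m) (by omega) hm
      (AdjoinRoot.root f ^ (N - k + r))
    refine ⟨t, ht, fun r' hr' => ?_⟩
    rw [← rootCoeff_tailEval hf hN (by omega), hθ, rootCoeff_root_pow hf (by omega)]
    simp
  rw [not_not] at h0
  rcases hcase with hcase | hcase | ⟨h, hh, rfl, rfl, hcase⟩
  · refine finrank_inf_add_le_of_coord (fun r => k + r)
      (fun v hv r hr => hV v hv _ (by omega) (by omega) (by omega)) fun r hr =>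
        ⟨_, H.stdVec_left_mem hn hf hN hkN hm (c := k + r) (by omega) (by omega),
          fun r' hr' => ?_⟩
    rw [coord_stdVec (by omega)]
    simp
  · refine finrank_inf_add_le_of_coord (fun r => o + k + (N - k + r))
      (fun v hv r hr => hV v hv _ (by omega) (by omega) (by omega)) fun r hr =>
        ⟨_, H.stdVec_tail_mem hn hf hN (Or.inl h0) hm (r := N - k + r) (by omega) (by omega)
          (by omega), fun r' hr' => ?_⟩
    rw [coord_stdVec (by omega)]
    simp
  -- Outside its left block, which `W'` contains, the space of `W` has only the middle block and
  -- the last `h` coordinates; the first `h` coordinates of the middle block may be among those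
  -- used by `W'` and are left out.
  · refine finrank_inf_add_le_of_coord (fun r => if r < h then o + k + (k + r) else o + r)
      (fun v hv r hr => hV v hv _ ?_ ?_ ?_) fun r hr => ?_
    · split_ifs <;> omega
    · split_ifs <;> omega
    · split_ifs <;> omega
    · by_cases hrh : r < h
      · refine ⟨_, H.stdVec_tail_mem hn hf hN (Or.inl h0) hm (r := k + r) (by omega) (by omega)
          (by omega), fun r' hr' => ?_⟩
        rw [coord_stdVec (by split_ifs <;> omega)]
        refine if_congr ?_ rfl rfl
        split_ifs <;> omega
      · refine ⟨_, H.stdVec_mid_mem hn hkN h0 hm hr (by omega), fun r' hr' => ?_⟩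
        rw [coord_stdVec (by split_ifs <;> omega)]
        refine if_congr ?_ rfl rfl
        split_ifs <;> omega

end IsCodeMatrix

theorem coord_matM (r : Fin (n - 1)) {c : ℕ} (hc : c < n) :
    coord F n c (matM F n r) = if c = n - 1 - r then 1 else 0 :=
  coord_stdVec hc _

theorem coord_eq_zero_of_mem_matM {c : ℕ} (hc : c + m < n) {v : Fin n → F}
    (hv : v ∈ rowSpace (firstRows (matM F n) m)) : coord F n c v = 0 := by
  refine eq_zero_of_mem_rowSpace_firstRows _ (fun r hr => ?_) hv
  rw [coord_matM r (by omega), if_neg (by omega)]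

theorem finrank_rowSpace_matM (hm : m ≤ n - 1) :
    Module.finrank F (rowSpace (firstRows (matM F n) m)) = m := by
  refine finrank_rowSpace_firstRows hm _ (fun r => coord F n (n - 1 - r)) fun r hr r' hr' => ?_
  rw [coord_matM _ (by omega)]
  exact if_congr (by omega) rfl rfl

theorem IsCodeMatrix.finrank_inf_matM_add_le [Fact (Irreducible f)]
    (H : IsCodeMatrix o k N γ W) (hn : o + k + N = n)
    (hf : f.Monic) (hN : f.natDegree = N) (hkN : k ≤ N) (hk : k ≤ m)
    (hm : m ≤ n - 1) (hmn : m + 2 * k ≤ n) (hNm : m ≤ N ∨ N + k ≤ m) :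
    Module.finrank F ↥(rowSpace (firstRows W m) ⊓ rowSpace (firstRows (matM F n) m)) + k ≤
      Module.finrank F (rowSpace (firstRows W m)) := by
  rcases hNm with hNm | hNm
  · exact finrank_inf_add_le_of_coord (fun r => o + r)
      (fun v hv r hr => coord_eq_zero_of_mem_matM (by omega) hv)
      fun r hr => H.exists_coord_mid hk hm hr
  · refine finrank_inf_add_le_of_coord (fun r => r)
      (fun v hv r hr => coord_eq_zero_of_mem_matM (by omega) hv) fun r hr =>
        ⟨_, H.stdVec_left_mem hn hf hN hkN hm (c := r) (by omega) (by omega), fun r' hr' => ?_⟩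
    rw [coord_stdVec (by omega)]

/-- The common rows of `A_i` and `B_i` span a space of dimension `m - k`. -/
theorem le_finrank_inf_add [Fact (Irreducible f)] {γ γ' : AdjoinRoot f}
    (H : IsCodeMatrix o k N γ W) (H' : IsCodeMatrix o k N γ' W') (hn : o + k + N = n)
    (hf : f.Monic) (hN : f.natDegree = N) (h0 : γ = 0) (h1 : γ' = 1) (hm : m ≤ n - 1)
    (hmN : m ≤ N) :
    m ≤ Module.finrank F ↥(rowSpace (firstRows W m) ⊓ rowSpace (firstRows W' m)) + k := by
  have hli : LinearIndependent F fun r : Fin (m - k) => stdVec F n (o + k + (k + r)) := by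
    rw [Fintype.linearIndependent_iff]
    intro b hb r
    have := congrArg (coord F n (o + k + (k + r))) hb
    simpa [coord_stdVec (show o + k + (k + (r : ℕ)) < n by omega), Fin.val_inj] using this
  have hle : Submodule.span F (Set.range fun r : Fin (m - k) => stdVec F n (o + k + (k + r))) ≤
      rowSpace (firstRows W m) ⊓ rowSpace (firstRows W' m) := by
    rw [Submodule.span_le]
    rintro _ ⟨r, rfl⟩
    exact ⟨H.stdVec_tail_mem hn hf hN (Or.inl h0) hm (by omega) (by omega) (by omega),
      H'.stdVec_tail_mem hn hf hN (Or.inr h1) hm (by omega) (by omega) (by omega)⟩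
  have := Submodule.finrank_mono hle
  rw [finrank_span_eq_card hli, Fintype.card_fin] at this
  omega

end Distance

/-! ### The hyperplanes spanned by all rows -/

section Hyperplane

variable {F : Type*} [Field F] {f f' : F[X]} {n o o' k N N' : ℕ}
  {γ : AdjoinRoot f} {γ' : AdjoinRoot f'} {W W' : Matrix (Fin (n - 1)) (Fin n) F}

namespace IsCodeMatrix

/-- The equation of the hyperplane spanned by all rows of `B_i`. -/
theorem coord_eq_zero_of_mem_hyperplane (H : IsCodeMatrix o k N γ W) (hn : o + k + N = n)
    (hkN : k ≤ N) (hk : 0 < k) (h0 : γ = 0) {v : Fin n → F}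
    (hv : v ∈ rowSpace (firstRows W (n - 1))) : coord F n (o + k + (k - 1)) v = 0 := by
  refine eq_zero_of_mem_rowSpace_firstRows _ (fun r hr => ?_) hv
  rw [H.tail_of_eq h0 _ _ (by omega), if_neg (by omega)]

variable [Fact (Irreducible f)] [Fact (Irreducible f')]

/-- The equation of the hyperplane spanned by all rows of `A_i g`. -/
theorem coord_eq_rootCoeff_of_mem_hyperplane (H : IsCodeMatrix o k N γ W)
    (hn : o + k + N = n) (hf : f.Monic) (hN : f.natDegree = N) (hkN : k ≤ N) (hk : 0 < k)
    (h0 : γ ≠ 0) {v : Fin n → F} (hv : v ∈ rowSpace (firstRows W (n - 1))) :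
    coord F n (o + (k - 1)) v = rootCoeff hf (k - 1) (γ⁻¹ * tailEval n (o + k) N f v) := by
  rw [← sub_eq_zero]
  refine eq_zero_of_mem_rowSpace_firstRows
    (coord F n (o + (k - 1)) -
      rootCoeff hf (k - 1) ∘ₗ LinearMap.mulLeft F γ⁻¹ ∘ₗ tailEval n (o + k) N f)
    (fun r hr => ?_) hv
  simp only [LinearMap.sub_apply, LinearMap.comp_apply, LinearMap.mulLeft_apply]
  rw [H.coord_mid _ _ (by omega), sub_eq_zero]
  by_cases hrN : (r : ℕ) < N + o
  · rw [H.rootCoeff_row hf hN h0 (by omega) hrN]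
    exact if_congr eq_comm rfl rfl
  · rw [H.tail_of_ne h0, inv_mul_cancel_left₀ h0, if_neg (by omega), if_neg (by omega),
      if_neg hrN, rootCoeff_root_pow hf (by omega), if_neg (by omega)]

theorem hyperplane_ne_matM (H : IsCodeMatrix o k N γ W) (hn : o + k + N = n) (hf : f.Monic)
    (hN : f.natDegree = N) (hkN : k ≤ N) (hk : 0 < k) (hkn : k < n) :
    rowSpace (firstRows W (n - 1)) ≠ rowSpace (firstRows (matM F n) (n - 1)) := by
  intro h
  rcases Nat.eq_zero_or_pos o with rfl | ho
  · obtain ⟨t, ht, htc⟩ := H.exists_coord_mid (m := n - 1) (by omega) le_rfl hk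
    rw [h] at ht
    have := htc 0 hk
    rw [zero_add, coord_eq_zero_of_mem_matM (by omega) ht] at this
    simp at this
  · have ht := H.stdVec_left_mem hn hf hN hkN (m := n - 1) le_rfl ho (by omega)
    rw [h] at ht
    have := coord_eq_zero_of_mem_matM (c := 0) (by omega) ht
    rw [coord_stdVec (by omega)] at this
    simp at this

/-- A hyperplane of some `A_i g` does not contain the last unit vector of the middle block. -/
theorem stdVec_notMem_hyperplane (H : IsCodeMatrix o k N γ W)
    (hn : o + k + N = n) (hf : f.Monic) (hN : f.natDegree = N) (hkN : k ≤ N) (hk : 0 < k)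
    (h0 : γ ≠ 0) : stdVec F n (o + (k - 1)) ∉ rowSpace (firstRows W (n - 1)) := by
  intro hv
  have := H.coord_eq_rootCoeff_of_mem_hyperplane hn hf hN hkN hk h0 hv
  rw [tailEval_eq_zero, mul_zero, map_zero, coord_stdVec (by omega)] at this
  · simp at this
  · intro c hc
    rw [coord_stdVec (by omega), if_neg (by omega)]

theorem hyperplane_ne_of_lt (H : IsCodeMatrix o k N γ W) (H' : IsCodeMatrix o' k N' γ' W')
    (hn : o + k + N = n) (hn' : o' + k + N' = n) (hf : f.Monic) (hN : f.natDegree = N)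
    (hkN : k ≤ N) (hf' : f'.Monic) (hN' : f'.natDegree = N') (hkN' : k ≤ N') (hk : 0 < k)
    (ho : o = o' + k ∨ o' + 2 * k ≤ o) :
    rowSpace (firstRows W (n - 1)) ≠ rowSpace (firstRows W' (n - 1)) := by
  intro h
  have hU : ∀ c < o, stdVec F n c ∈ rowSpace (firstRows W' (n - 1)) := fun c hc => by
    rw [← h]
    exact H.stdVec_left_mem hn hf hN hkN le_rfl hc (by omega)
  by_cases h0' : γ' ≠ 0
  · exact H'.stdVec_notMem_hyperplane hn' hf' hN' hkN' hk h0' (hU _ (by omega))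
  rw [not_not] at h0'
  rcases ho with rfl | ho
  · obtain ⟨t, ht, htc⟩ := H.exists_coord_mid (m := n - 1) (by omega) le_rfl
      (Nat.sub_lt hk one_pos)
    rw [h] at ht
    have := htc (k - 1) (by omega)
    rw [H'.coord_eq_zero_of_mem_hyperplane hn' hkN' hk h0' ht] at this
    simp at this
  · have := H'.coord_eq_zero_of_mem_hyperplane hn' hkN' hk h0' (hU (o' + k + (k - 1)) (by omega))
    rw [coord_stdVec (by omega)] at this
    simp at this

theorem hyperplane_ne_of_eq_zero {γ γ' : AdjoinRoot f} (H : IsCodeMatrix o k N γ W)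
    (H' : IsCodeMatrix o k N γ' W') (hn : o + k + N = n) (hf : f.Monic)
    (hN : f.natDegree = N) (hkN : k ≤ N) (hk : 0 < k) (h0 : γ = 0) (h0' : γ' ≠ 0) :
    rowSpace (firstRows W (n - 1)) ≠ rowSpace (firstRows W' (n - 1)) := by
  intro h
  refine H'.stdVec_notMem_hyperplane hn hf hN hkN hk h0' ?_
  rw [← h]
  exact H.stdVec_mid_mem hn hkN h0 le_rfl (by omega) (by omega)

/-- If the hyperplanes of `A_i g` and `A_i g'` agree, then multiplication by the quotient `μ` of
the two field elements preserves the coefficient of `x^(k-1)`, which forces `μ = 1`. -/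
theorem hyperplane_ne_of_ne_zero {γ γ' : AdjoinRoot f} (H : IsCodeMatrix o k N γ W)
    (H' : IsCodeMatrix o k N γ' W') (hn : o + k + N = n) (hf : f.Monic)
    (hN : f.natDegree = N) (hkN : k ≤ N) (hk : 0 < k) (h0 : γ ≠ 0) (h0' : γ' ≠ 0)
    (hne : γ ≠ γ') (hNn : N ≤ n - 1) :
    rowSpace (firstRows W (n - 1)) ≠ rowSpace (firstRows W' (n - 1)) := by
  intro h
  have hμ : γ'⁻¹ * γ - 1 ≠ 0 := by
    intro h1
    exact hne ((eq_inv_mul_iff_mul_eq₀ h0').1 (sub_eq_zero.1 h1).symm ▸ (mul_one _))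
  have hrow : ∀ r < N, rootCoeff hf (k - 1) ((γ'⁻¹ * γ - 1) * AdjoinRoot.root f ^ r) = 0 := by
    intro r hr
    have hmem := row_mem_rowSpace_firstRows W (m := n - 1) ⟨r, by omega⟩ (by simp; omega)
    rw [h] at hmem
    have := H'.coord_eq_rootCoeff_of_mem_hyperplane hn hf hN hkN hk h0' hmem
    rw [H.coord_mid _ _ (by omega), H.tail_of_ne h0, if_pos hr] at this
    rw [sub_mul, one_mul, map_sub, mul_assoc, ← this, rootCoeff_root_pow hf (by omega),
      sub_eq_zero]
    exact if_congr eq_comm rfl rfl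
  have hall : ∀ w, rootCoeff hf (k - 1) ((γ'⁻¹ * γ - 1) * w) = 0 := by
    intro w
    rw [← sum_rootCoeff hf hN w, Finset.mul_sum, map_sum]
    refine Finset.sum_eq_zero fun c hc => ?_
    rw [mul_smul_comm, map_smul, hrow c (Finset.mem_range.1 hc), smul_zero]
  have := hall ((γ'⁻¹ * γ - 1)⁻¹ * AdjoinRoot.root f ^ (k - 1))
  rw [mul_inv_cancel_left₀ hμ, rootCoeff_root_pow hf (by omega), if_pos rfl] at this
  exact one_ne_zero this

end IsCodeMatrix

end Hyperplane

/-! ### The groups `G_i` as multiplication by field elements -/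

section Group

variable {F : Type*} [Field F] {f : F[X]}

/-- The matrix `g` acts as `γ` if, on row vectors, it fixes the first `a` coordinates and
multiplies the element of `F[x]/(f)` given by the remaining `N` coordinates by `γ`. -/
def ActsAs {n : ℕ} (a N : ℕ) (γ : AdjoinRoot f) (g : Matrix (Fin n) (Fin n) F) : Prop :=
  ∀ v : Fin n → F, (∀ c < a, coord F n c (Matrix.vecMul v g) = coord F n c v) ∧
    tailEval n a N f (Matrix.vecMul v g) = γ * tailEval n a N f v

namespace ActsAs

variable {n a N : ℕ} {γ δ : AdjoinRoot f} {g g' : Matrix (Fin n) (Fin n) F}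

theorem one : ActsAs a N (1 : AdjoinRoot f) (1 : Matrix (Fin n) (Fin n) F) := by
  intro v
  simp

theorem mul (h : ActsAs a N γ g) (h' : ActsAs a N δ g') : ActsAs a N (γ * δ) (g * g') := by
  intro v
  rw [← Matrix.vecMul_vecMul]
  refine ⟨fun c hc => ((h' _).1 c hc).trans ((h v).1 c hc), ?_⟩
  rw [(h' _).2, (h v).2]
  ring

theorem pow (h : ActsAs a N γ g) (l : ℕ) : ActsAs a N (γ ^ l) (g ^ l) := by
  induction l with
  | zero => simpa using one
  | succ l ih => simpa only [pow_succ] using ih.mul h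

theorem inv [Fact (Irreducible f)] {g : Matrix.GeneralLinearGroup (Fin n) F}
    (h : ActsAs a N γ (g : Matrix (Fin n) (Fin n) F)) (h0 : γ ≠ 0) :
    ActsAs a N γ⁻¹ ((g⁻¹ : Matrix.GeneralLinearGroup (Fin n) F) : Matrix (Fin n) (Fin n) F) := by
  intro v
  have hv : Matrix.vecMul (Matrix.vecMul v
      ((g⁻¹ : Matrix.GeneralLinearGroup (Fin n) F) : Matrix (Fin n) (Fin n) F))
      (g : Matrix (Fin n) (Fin n) F) = v := by
    rw [Matrix.vecMul_vecMul, Units.inv_mul, Matrix.vecMul_one]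
  have := h (Matrix.vecMul v
    ((g⁻¹ : Matrix.GeneralLinearGroup (Fin n) F) : Matrix (Fin n) (Fin n) F))
  rw [hv] at this
  refine ⟨fun c hc => (this.1 c hc).symm, ?_⟩
  rw [this.2, inv_mul_cancel_left₀ h0]

/-- A matrix acting as a nonzero element is invertible. -/
theorem isUnit [Fact (Irreducible f)] (h : ActsAs a N γ g) (hn : a + N = n) (hf : f.Monic)
    (hN : f.natDegree = N) (h0 : γ ≠ 0) : IsUnit g := by
  rw [← Matrix.vecMul_injective_iff_isUnit]
  have hker : ∀ v, Matrix.vecMul v g = 0 → v = 0 := by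
    intro v hv
    obtain ⟨h1, h2⟩ := h v
    rw [hv] at h1 h2
    rw [map_zero, zero_eq_mul] at h2
    refine ext_coord fun c hc => ?_
    rw [map_zero]
    by_cases hca : c < a
    · rw [← h1 c hca, map_zero]
    · obtain ⟨d, rfl⟩ := Nat.exists_eq_add_of_le (not_lt.1 hca)
      rw [← rootCoeff_tailEval hf hN (by omega), h2.resolve_left h0, map_zero]
  intro v w hvw
  rw [← sub_eq_zero]
  refine hker _ ?_
  rw [Matrix.sub_vecMul]
  exact sub_eq_zero.2 hvw

end ActsAs

/-- Multiplication by the companion matrix is multiplication by the root. -/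
theorem sum_companionRow (hf : f.Monic) {N r : ℕ} (hN : f.natDegree = N) (hr : r < N) :
    ∑ c ∈ Finset.range N, companionRow N f r c • AdjoinRoot.root f ^ c =
      AdjoinRoot.root f ^ (r + 1) := by
  rcases Nat.lt_or_ge (r + 1) N with h | h
  · rw [Finset.sum_eq_single (r + 1)]
    · simp [companionRow, h, unitRow]
    · intro c _ hne
      simp [companionRow, h, unitRow, hne]
    · simp [h]
  · have hrN : r + 1 = N := by omega
    have h0 : Polynomial.aeval (AdjoinRoot.root f) f = 0 := by
      rw [AdjoinRoot.aeval_eq, AdjoinRoot.mk_self]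
    rw [Polynomial.aeval_eq_sum_range, hN, Finset.sum_range_succ, ← hN, hf.coeff_natDegree, hN,
      one_smul] at h0
    rw [hrN, eq_neg_of_add_eq_zero_right h0, ← Finset.sum_neg_distrib]
    refine Finset.sum_congr rfl fun c _ => ?_
    rw [companionRow, if_neg (by omega), neg_smul]

theorem actsAs_of_rows {n a N : ℕ} (hn : a + N = n) {γ : AdjoinRoot f}
    {g : Matrix (Fin n) (Fin n) F}
    (h1 : ∀ r : Fin n, ∀ c < a, coord F n c (g r) = if c = (r : ℕ) then 1 else 0)
    (h2 : ∀ r : Fin n, tailEval n a N f (g r) =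
      γ * if (r : ℕ) < a then 0 else AdjoinRoot.root f ^ ((r : ℕ) - a)) : ActsAs a N γ g := by
  have hs : ∀ r : Fin n, (Pi.single r 1 : Fin n → F) = stdVec F n r := by
    intro r
    ext x
    simp only [stdVec, unitRow, Pi.single_apply, Fin.ext_iff]
  intro v
  constructor
  · intro c hc
    have : coord F n c ∘ₗ Matrix.vecMulLinear g = coord F n c := by
      refine LinearMap.pi_ext' fun r => LinearMap.ext_ring ?_
      simp only [LinearMap.comp_apply, Matrix.vecMulLinear_apply, LinearMap.single_apply,
        Matrix.single_one_vecMul]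
      rw [hs, coord_stdVec (by omega)]
      exact h1 r c hc
    exact LinearMap.congr_fun this v
  · have : tailEval n a N f ∘ₗ Matrix.vecMulLinear g =
        LinearMap.mulLeft F γ ∘ₗ tailEval n a N f := by
      refine LinearMap.pi_ext' fun r => LinearMap.ext_ring ?_
      simp only [LinearMap.comp_apply, Matrix.vecMulLinear_apply, LinearMap.single_apply,
        Matrix.single_one_vecMul, LinearMap.mulLeft_apply]
      rw [hs]
      refine (h2 r).trans ?_
      by_cases hr : (r : ℕ) < a
      · rw [if_pos hr, tailEval_eq_zero]
        intro c hc
        rw [coord_stdVec (by omega), if_neg (by omega)]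
      · rw [if_neg hr, tailEval_of_coord (r := (r : ℕ) - a) (by omega)]
        intro c hc
        rw [coord_stdVec (by omega)]
        exact if_congr (by omega) rfl rfl
    exact LinearMap.congr_fun this v

theorem block_add {s k h i : ℕ} (hi : 1 ≤ i) (his : i ≤ s - 1) :
    (s - i - 1) * k + k + (i * k + h) = s * k + h := by
  obtain ⟨d, rfl⟩ : ∃ d, s = i + 1 + d := ⟨s - i - 1, by omega⟩
  rw [show i + 1 + d - i - 1 = d by omega]
  ring

theorem actsAs_genMatrix {s k h i : ℕ} (hi : 1 ≤ i) (his : i ≤ s - 1) (hf : f.Monic)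
    (hN : f.natDegree = i * k + h) :
    ActsAs ((s - i - 1) * k + k) (i * k + h) (AdjoinRoot.root f) (genMatrix s k h i f) := by
  have hn := block_add (k := k) (h := h) hi his
  refine actsAs_of_rows hn (fun r c hc => ?_) fun r => ?_
  · rw [coord_apply (by omega)]
    simp only [genMatrix, Matrix.of_apply]
    generalize (s - i - 1) * k = o at *
    split_ifs with h1 h2 h3 h3 <;> simp only [blockRow, unitRow, Pi.single_apply, Pi.zero_apply]
      <;> split_ifs <;> first | rfl | omega
  · have hcoord : ∀ c < i * k + h, coord F (s * k + h) ((s - i - 1) * k + k + c)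
        (genMatrix s k h i f r) = if (r : ℕ) < (s - i - 1) * k + k then 0
          else companionRow (i * k + h) f (r - (s - i - 1) * k - k) c := by
      intro c hc
      rw [coord_apply (by omega)]
      simp only [genMatrix, Matrix.of_apply]
      generalize (s - i - 1) * k = o at *
      have e : o + k + c - o - k = c := by omega
      split_ifs <;> simp only [blockRow, Pi.zero_apply, e] <;> split_ifs <;> first | rfl | omega
    rw [tailEval_apply, Finset.sum_congr rfl fun c hc => by rw [hcoord c (Finset.mem_range.1 hc)]]
    by_cases hr : (r : ℕ) < (s - i - 1) * k + k
    · simp [hr]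
    · simp only [if_neg hr]
      rw [sum_companionRow hf hN (by omega), pow_succ', Nat.sub_sub]

theorem natCard_adjoinRoot [Fintype F] (hf : f.Monic) :
    Nat.card (AdjoinRoot f) = Fintype.card F ^ f.natDegree := by
  have : Module.Finite F (AdjoinRoot f) := (AdjoinRoot.powerBasis hf.ne_zero).finite
  rw [Module.natCard_eq_pow_finrank (K := F), Nat.card_eq_fintype_card,
    (AdjoinRoot.powerBasis hf.ne_zero).finrank, AdjoinRoot.powerBasis_dim]

theorem root_ne_zero [Fintype F] [Fact (Irreducible f)] (hf : IsPrimitivePoly f) :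
    AdjoinRoot.root f ≠ 0 := by
  have : Module.Finite F (AdjoinRoot f) := (AdjoinRoot.powerBasis hf.1.ne_zero).finite
  have : Finite (AdjoinRoot f) := Module.finite_of_finite F
  have hcard := natCard_adjoinRoot hf.1
  have hlt : 1 < Nat.card (AdjoinRoot f) := Finite.one_lt_card
  intro h
  have h1 := hf.2.2
  rw [h, orderOf_zero] at h1
  omega

theorem exists_pow_root_eq [Fintype F] [Fact (Irreducible f)] (hf : IsPrimitivePoly f)
    {γ : AdjoinRoot f} (h0 : γ ≠ 0) : ∃ l : ℕ, AdjoinRoot.root f ^ l = γ := by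
  have : Module.Finite F (AdjoinRoot f) := (AdjoinRoot.powerBasis hf.1.ne_zero).finite
  have : Finite (AdjoinRoot f) := Module.finite_of_finite F
  have hcard := natCard_adjoinRoot hf.1
  have hroot := root_ne_zero hf
  have hu : orderOf (Units.mk0 _ hroot) = Nat.card (AdjoinRoot f)ˣ := by
    rw [← orderOf_units, Units.val_mk0, hf.2.2, Nat.card_units, hcard]
  have htop : Subgroup.zpowers (Units.mk0 _ hroot) = ⊤ :=
    Subgroup.eq_top_of_card_eq _ (by rw [Nat.card_zpowers, hu])
  obtain ⟨l, hl⟩ := mem_powers_iff_mem_zpowers.2 (htop ▸ Subgroup.mem_top (Units.mk0 γ h0))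
  exact ⟨l, by simpa using congrArg Units.val hl⟩

theorem exists_actsAs_of_mem_groupG [Fact (Irreducible f)] {s k h i : ℕ} (hi : 1 ≤ i)
    (his : i ≤ s - 1) (hf : f.Monic) (hN : f.natDegree = i * k + h)
    (hroot : AdjoinRoot.root f ≠ 0) {g : Matrix.GeneralLinearGroup (Fin (s * k + h)) F}
    (hg : g ∈ groupG s k h i f) : ∃ γ : AdjoinRoot f, γ ≠ 0 ∧
      ActsAs ((s - i - 1) * k + k) (i * k + h) γ
        (g : Matrix (Fin (s * k + h)) (Fin (s * k + h)) F) := by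
  induction hg using Subgroup.closure_induction with
  | mem g hg =>
    refine ⟨AdjoinRoot.root f, hroot, ?_⟩
    rw [show (g : Matrix (Fin (s * k + h)) (Fin (s * k + h)) F) = genMatrix s k h i f from hg]
    exact actsAs_genMatrix hi his hf hN
  | one => exact ⟨1, one_ne_zero, ActsAs.one⟩
  | mul g g' _ _ ih ih' =>
    obtain ⟨γ, h0, hγ⟩ := ih
    obtain ⟨δ, h0', hδ⟩ := ih'
    exact ⟨γ * δ, mul_ne_zero h0 h0', hγ.mul hδ⟩
  | inv g _ ih =>
    obtain ⟨γ, h0, hγ⟩ := ih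
    exact ⟨γ⁻¹, inv_ne_zero h0, hγ.inv h0⟩

theorem exists_mem_groupG_actsAs [Fintype F] [Fact (Irreducible f)] {s k h i : ℕ} (hi : 1 ≤ i)
    (his : i ≤ s - 1) (hf : IsPrimitivePoly f) (hN : f.natDegree = i * k + h)
    (hroot : AdjoinRoot.root f ≠ 0) {γ : AdjoinRoot f} (h0 : γ ≠ 0) :
    ∃ g ∈ groupG s k h i f, ActsAs ((s - i - 1) * k + k) (i * k + h) γ
      (g : Matrix (Fin (s * k + h)) (Fin (s * k + h)) F) := by
  obtain ⟨l, rfl⟩ := exists_pow_root_eq hf h0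
  have hgen := actsAs_genMatrix hi his hf.1 hN
  obtain ⟨u, hu⟩ := hgen.isUnit (block_add hi his) hf.1 hN hroot
  have hmem : u ∈ groupG s k h i f := Subgroup.subset_closure hu
  refine ⟨u ^ l, Subgroup.pow_mem _ hmem l, ?_⟩
  rw [Units.val_pow_eq_pow_val, hu]
  exact hgen.pow l

end Group

/-! ### The rows of the matrices of the construction -/

section Rows

variable {F : Type*} [Field F] {f : F[X]} {s k h i : ℕ}

theorem isCodeMatrix_matB (hi : 1 ≤ i) (his : i ≤ s - 1) :
    IsCodeMatrix ((s - i - 1) * k) k (i * k + h) (0 : AdjoinRoot f) (matB F s k h i) := by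
  have hn := block_add (k := k) (h := h) hi his
  have hkN : k ≤ i * k + h := (Nat.le_mul_of_pos_left k hi).trans (Nat.le_add_right _ _)
  refine ⟨fun r c hc => ?_, fun r c hc => ?_, fun h0 => absurd rfl h0, fun _ r c hc => ?_⟩
  all_goals
    rw [coord_apply (by omega)]
    simp only [matB, Matrix.of_apply]
    have hr := r.2
    generalize (s - i - 1) * k = o at *
    generalize i * k + h = N at *
    generalize (r : ℕ) = r' at *
    split_ifs <;> simp only [blockRow, unitRow, Pi.single_apply, Pi.zero_apply] <;>
      split_ifs <;> first | rfl | omega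

theorem matA_coord (hi : 1 ≤ i) (his : i ≤ s - 1) (r : Fin (s * k + h - 1)) :
    (∀ c < (s - i - 1) * k, coord F (s * k + h) c (matA F s k h i r) =
      if (r : ℕ) = i * k + h + c then 1 else 0) ∧
    (∀ c < k, coord F (s * k + h) ((s - i - 1) * k + c) (matA F s k h i r) =
      if (r : ℕ) = c then 1 else 0) ∧
    ∀ c < i * k + h, coord F (s * k + h) ((s - i - 1) * k + k + c) (matA F s k h i r) =
      if (r : ℕ) = c ∨ (r : ℕ) = i * k + h + (s - i - 1) * k + c then 1 else 0 := by
  have hn := block_add (k := k) (h := h) hi his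
  have hkN : k ≤ i * k + h := (Nat.le_mul_of_pos_left k hi).trans (Nat.le_add_right _ _)
  refine ⟨fun c hc => ?_, fun c hc => ?_, fun c hc => ?_⟩
  all_goals
    rw [coord_apply (by omega)]
    simp only [matA, Matrix.of_apply]
    have hr := r.2
    generalize (s - i - 1) * k = o at *
    generalize i * k + h = N at *
    generalize (r : ℕ) = r' at *
    split_ifs <;> simp only [blockRow, unitRow, Pi.single_apply, Pi.zero_apply] <;>
      split_ifs <;> first | rfl | omega

theorem isCodeMatrix_matA_mul (hi : 1 ≤ i) (his : i ≤ s - 1) {γ : AdjoinRoot f}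
    (h0 : γ ≠ 0) {g : Matrix (Fin (s * k + h)) (Fin (s * k + h)) F}
    (hg : ActsAs ((s - i - 1) * k + k) (i * k + h) γ g) :
    IsCodeMatrix ((s - i - 1) * k) k (i * k + h) γ (matA F s k h i * g) := by
  have hn := block_add (k := k) (h := h) hi his
  have hkN : k ≤ i * k + h := (Nat.le_mul_of_pos_left k hi).trans (Nat.le_add_right _ _)
  have hrow : ∀ r, (matA F s k h i * g) r = Matrix.vecMul (matA F s k h i r) g := fun _ => rfl
  refine ⟨fun r c hc => ?_, fun r c hc => ?_, fun _ r => ?_, fun h => absurd h h0⟩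
  · rw [hrow, (hg _).1 c (by omega), (matA_coord hi his r).1 c hc]
  · rw [hrow, (hg _).1 _ (by omega), (matA_coord hi his r).2.1 c hc]
  · have hc := (matA_coord (F := F) (k := k) (h := h) hi his r).2.2
    rw [hrow, (hg _).2]
    congr 1
    have hr := r.2
    split_ifs with h1 h2
    · refine tailEval_of_coord h1 fun c hcN => ?_
      rw [hc c hcN]
      exact if_congr (by omega) rfl rfl
    · refine tailEval_eq_zero fun c hcN => ?_
      rw [hc c hcN, if_neg (by omega)]
    · refine tailEval_of_coord (by omega) fun c hcN => ?_
      rw [hc c hcN]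
      exact if_congr (by omega) rfl rfl

/-- The matrix `A_i g` is determined by the element as which `g` acts. -/
theorem IsCodeMatrix.ext {n o k N : ℕ} {γ : AdjoinRoot f} {W W' : Matrix (Fin (n - 1)) (Fin n) F}
    (H : IsCodeMatrix o k N γ W) (H' : IsCodeMatrix o k N γ W') (hn : o + k + N = n)
    (hf : f.Monic) (hN : f.natDegree = N) : W = W' := by
  funext r
  refine ext_coord_blocks hn (fun c hc => ?_) (fun c hc => ?_) fun c hc => ?_
  · rw [H.coord_left r c hc, H'.coord_left r c hc]
  · rw [H.coord_mid r c hc, H'.coord_mid r c hc]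
  · by_cases h0 : γ = 0
    · rw [H.tail_of_eq h0 r c hc, H'.tail_of_eq h0 r c hc]
    · rw [← rootCoeff_tailEval hf hN hc, ← rootCoeff_tailEval hf hN hc, H.tail_of_ne h0 r,
        H'.tail_of_ne h0 r]

end Rows

/-! ### Dimension and cardinality of the codes -/

section Codes

/-- A family of `m`-dimensional spaces whose pairwise intersections have dimension at most
`m - k`, with equality for some pair, is injective of minimum distance `2 k`. -/
theorem injective_and_minDist_range {F : Type*} [Field F] {ι : Type*} {n m k : ℕ} (hk : 0 < k)
    (U : ι → Submodule F (Fin n → F)) (hdim : ∀ x, Module.finrank F (U x) = m)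
    (hle : ∀ x y, x ≠ y → Module.finrank F ↥(U x ⊓ U y) + k ≤ m)
    (hge : ∃ x y, x ≠ y ∧ m ≤ Module.finrank F ↥(U x ⊓ U y) + k) :
    Function.Injective U ∧ minDist (Set.range U) = 2 * k := by
  have hinj : Function.Injective U := by
    intro x y hxy
    by_contra hne
    have := hle x y hne
    rw [← hxy, inf_idem, hdim] at this
    omega
  refine ⟨hinj, le_antisymm ?_ ?_⟩
  · obtain ⟨x, y, hne, hxy⟩ := hge
    have hmem : minDist (Set.range U) ≤ subspaceDist (U x) (U y) :=
      Nat.sInf_le ⟨U x, ⟨x, rfl⟩, U y, ⟨y, rfl⟩, hinj.ne hne, rfl⟩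
    refine hmem.trans ?_
    have := subspaceDist_add (hdim x) (hdim y)
    omega
  · obtain ⟨x, y, hne, -⟩ := hge
    refine le_csInf ⟨_, U x, ⟨x, rfl⟩, U y, ⟨y, rfl⟩, hinj.ne hne, rfl⟩ ?_
    rintro d ⟨_, ⟨x, rfl⟩, _, ⟨y, rfl⟩, hxy, rfl⟩
    have := subspaceDist_add (hdim x) (hdim y)
    have := hle x y fun h => hxy (congrArg U h)
    omega

variable {F : Type*} [Field F] {s k h : ℕ} {f : ℕ → F[X]}

theorem rowSpace_eq_firstRows {n : ℕ} (W : Matrix (Fin (n - 1)) (Fin n) F) :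
    rowSpace W = rowSpace (firstRows W (n - 1)) := by
  refine le_antisymm (Submodule.span_le.2 ?_) (Submodule.span_mono ?_)
  · rintro _ ⟨r, rfl⟩
    exact row_mem_rowSpace_firstRows W r r.2
  · rintro _ ⟨r, rfl⟩
    exact ⟨r.1, rfl⟩

/-- The generator matrices are indexed by the pairs `(i, γ)` with `γ` in `F[x]/(f_i)`, where
`γ = 0` belongs to `B_i`, and one further index for `M`. -/
abbrev GeneratorIndex (s : ℕ) (f : ℕ → F[X]) : Type _ :=
  Option (Σ i : ↥(Finset.Icc 1 (s - 1)), AdjoinRoot (f i))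

theorem natCard_generatorIndex [Fintype F]
    (hf : ∀ i, 1 ≤ i → i ≤ s - 1 → IsPrimitivePoly (f i) ∧ (f i).natDegree = i * k + h) :
    Nat.card (GeneratorIndex s f) =
      (∑ i ∈ Finset.Icc 1 (s - 1), Fintype.card F ^ (i * k + h)) + 1 := by
  have hi : ∀ i : ↥(Finset.Icc 1 (s - 1)), 1 ≤ (i : ℕ) ∧ (i : ℕ) ≤ s - 1 :=
    fun i => Finset.mem_Icc.1 i.2
  have : ∀ i : ↥(Finset.Icc 1 (s - 1)), Finite (AdjoinRoot (f i)) := fun i => by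
    have : Module.Finite F (AdjoinRoot (f i)) :=
      (AdjoinRoot.powerBasis (hf i (hi i).1 (hi i).2).1.1.ne_zero).finite
    exact Module.finite_of_finite F
  rw [Finite.card_option, Nat.card_sigma,
    ← Finset.sum_coe_sort (Finset.Icc 1 (s - 1)) fun i => Fintype.card F ^ (i * k + h)]
  congr 1
  refine Finset.sum_congr rfl fun i _ => ?_
  obtain ⟨h1, h2⟩ := hf i (hi i).1 (hi i).2
  rw [natCard_adjoinRoot h1.1, h2]

theorem exists_generator_enumeration [Fintype F]
    (hf : ∀ i, 1 ≤ i → i ≤ s - 1 → IsPrimitivePoly (f i) ∧ (f i).natDegree = i * k + h) :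
    ∃ W : GeneratorIndex s f → Matrix (Fin (s * k + h - 1)) (Fin (s * k + h)) F,
      Set.range W = generatorMatrices s k h f ∧ W none = matM F (s * k + h) ∧
      ∀ x : Σ i : ↥(Finset.Icc 1 (s - 1)), AdjoinRoot (f i),
        IsCodeMatrix ((s - x.1 - 1) * k) k (x.1 * k + h) x.2 (W (some x)) := by
  have hex : ∀ x : Σ i : ↥(Finset.Icc 1 (s - 1)), AdjoinRoot (f i),
      ∃ W ∈ generatorMatrices s k h f,
        IsCodeMatrix ((s - x.1 - 1) * k) k (x.1 * k + h) x.2 W := by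
    rintro ⟨⟨i, hi⟩, γ⟩
    obtain ⟨hi, his⟩ := Finset.mem_Icc.1 hi
    obtain ⟨h1, h2⟩ := hf i hi his
    have := Fact.mk h1.2.1
    by_cases h0 : γ = 0
    · exact ⟨_, Or.inr (Or.inl ⟨i, hi, his, rfl⟩), h0 ▸ isCodeMatrix_matB hi his⟩
    · obtain ⟨g, hg, hγ⟩ := exists_mem_groupG_actsAs hi his h1 h2 (root_ne_zero h1) h0
      exact ⟨_, Or.inl ⟨i, hi, his, g, hg, rfl⟩, isCodeMatrix_matA_mul hi his h0 hγ⟩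
  choose W hW hWc using hex
  refine ⟨fun x => x.elim (matM F (s * k + h)) W, ?_, rfl, hWc⟩
  refine Set.Subset.antisymm ?_ ?_
  · rintro _ ⟨_ | x, rfl⟩
    · exact Or.inr (Or.inr rfl)
    · exact hW x
  · rintro _ (⟨i, hi, his, g, hg, rfl⟩ | ⟨i, hi, his, rfl⟩ | rfl)
    · obtain ⟨h1, h2⟩ := hf i hi his
      have := Fact.mk h1.2.1
      obtain ⟨γ, h0, hγ⟩ := exists_actsAs_of_mem_groupG hi his h1.1 h2 (root_ne_zero h1) hg
      exact ⟨some ⟨⟨i, Finset.mem_Icc.2 ⟨hi, his⟩⟩, γ⟩,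
        (hWc ⟨⟨i, Finset.mem_Icc.2 ⟨hi, his⟩⟩, γ⟩).ext (isCodeMatrix_matA_mul hi his h0 hγ)
          (block_add hi his) h1.1 h2⟩
    · obtain ⟨h1, h2⟩ := hf i hi his
      exact ⟨some ⟨⟨i, Finset.mem_Icc.2 ⟨hi, his⟩⟩, 0⟩,
        (hWc ⟨⟨i, Finset.mem_Icc.2 ⟨hi, his⟩⟩, 0⟩).ext (isCodeMatrix_matB hi his)
          (block_add hi his) h1.1 h2⟩
    · exact ⟨none, rfl⟩

theorem projectedCode_flagCode {n m : ℕ} (S : Set (Matrix (Fin (n - 1)) (Fin n) F))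
    (hm : 1 ≤ m ∧ m ≤ n - 1) :
    projectedCode (flagOf '' S) m = (fun W => rowSpace (firstRows W m)) '' S := by
  ext U
  constructor
  · rintro ⟨_, _, ⟨W, hW, rfl⟩, rfl⟩
    exact ⟨W, hW, rfl⟩
  · rintro ⟨W, hW, rfl⟩
    exact ⟨hm, _, ⟨W, hW, rfl⟩, rfl⟩

/-- Two code matrices of different types `i < i'`. Here `j = 1` if `m ≤ k + h`, and `m = j k + h`
otherwise. -/
theorem finrank_inf_add_le_of_lt {m i i' j : ℕ} (hi : 1 ≤ i) (hii : i < i')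
    (his : i' ≤ s - 1) (hjs : j + 2 ≤ s) (hs5 : 2 ≤ j → 5 ≤ s)
    (hle : ∀ l, j ≤ l → m ≤ l * k + h) (hlt : 1 < j → m = j * k + h) (hhk : h < k)
    (hkm : k ≤ m) (hmn : m + 2 * k ≤ s * k + h)
    [Fact (Irreducible (f i))] [Fact (Irreducible (f i'))]
    (hf : (f i).Monic) (hN : (f i).natDegree = i * k + h)
    (hf' : (f i').Monic) (hN' : (f i').natDegree = i' * k + h)
    {γ : AdjoinRoot (f i)} {γ' : AdjoinRoot (f i')}
    {W W' : Matrix (Fin (s * k + h - 1)) (Fin (s * k + h)) F}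
    (H : IsCodeMatrix ((s - i - 1) * k) k (i * k + h) γ W)
    (H' : IsCodeMatrix ((s - i' - 1) * k) k (i' * k + h) γ' W')
    (hd : Module.finrank F (rowSpace (firstRows W m)) = m)
    (hd' : Module.finrank F (rowSpace (firstRows W' m)) = m) :
    Module.finrank F ↥(rowSpace (firstRows W m) ⊓ rowSpace (firstRows W' m)) + k ≤ m := by
  have hn := block_add (k := k) (h := h) hi (by omega : i ≤ s - 1)
  have hn' := block_add (k := k) (h := h) (by omega : 1 ≤ i') his
  have hkN : k ≤ i * k := Nat.le_mul_of_pos_left k hi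
  have hmul : ∀ a b c : ℕ, a + c ≤ b → a * k + c * k ≤ b * k := fun a b c hab => by
    rw [← add_mul]
    exact Nat.mul_le_mul_right k hab
  have h1 := hmul i i' 1 hii
  have hm1 : m ≤ s * k + h - 1 := by omega
  by_cases hji : j ≤ i
  · rw [inf_comm]
    conv_rhs => rw [← hd']
    exact H.finrank_inf_add_le_of_le H' (by omega) hkm hm1 (hle i hji)
  have hmj := hlt (by omega)
  have h2 := hmul i j 1 (by omega)
  conv_rhs => rw [← hd]
  by_cases hi's : i' < s - 1
  · have h3 := hmul j s 2 hjs
    have h4 := hmul i' s 2 (by omega)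
    exact H.finrank_inf_add_le_of_left H' hn hn' hf hN (by omega) hm1 (by omega) (by omega)
      (by omega)
  · have h0 : (s - i' - 1) * k = 0 := by rw [show s - i' - 1 = 0 by omega, zero_mul]
    rw [h0] at H' hn'
    refine H.finrank_inf_add_le_of_last H' hn hn' hf hN (by omega) hf' hN' hm1 hmn (by omega) ?_
    by_cases hij : i + 2 ≤ j
    · have := hmul i j 2 hij
      exact Or.inl (by omega)
    by_cases h2i : 2 ≤ i
    · have := hmul 0 i 2 (by omega)
      exact Or.inr (Or.inl (by omega))
    · obtain rfl : i = 1 := by omega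
      obtain rfl : j = 2 := by omega
      have := hmul 0 s 5 (by have := hs5 le_rfl; omega)
      exact Or.inr (Or.inr ⟨h, hhk, by omega, hmj, by omega⟩)

end Codes

end FlagCode

open FlagCode in
theorem theorem4p1 {F : Type*} [Field F] [Fintype F] (s k h : ℕ)
    (hs : 3 ≤ s) (hs4 : s ≠ 4) (hhk : h < k)
    (f : ℕ → Polynomial F)
    (hf : ∀ i, 1 ≤ i → i ≤ s - 1 →
      FlagCode.IsPrimitivePoly (f i) ∧ (f i).natDegree = i * k + h) :
    (∀ m : ℕ, ((k + 1 ≤ m ∧ m ≤ k + h) ∨ ∃ j, 2 ≤ j ∧ j ≤ s - 2 ∧ m = j * k + h) →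
      (∀ U ∈ FlagCode.projectedCode (FlagCode.flagCode s k h f) m, Module.finrank F U = m) ∧
      FlagCode.minDist (FlagCode.projectedCode (FlagCode.flagCode s k h f) m) = 2 * k ∧
      (FlagCode.projectedCode (FlagCode.flagCode s k h f) m).ncard =
        (∑ i ∈ Finset.Icc 1 (s - 1), Fintype.card F ^ (i * k + h)) + 1) ∧
    (FlagCode.flagCode s k h f).ncard =
      (∑ i ∈ Finset.Icc 1 (s - 1), Fintype.card F ^ (i * k + h)) + 1 ∧
    (FlagCode.subspaceCode s k h f).ncard =
      (∑ i ∈ Finset.Icc 1 (s - 1), Fintype.card F ^ (i * k + h)) + 1 := by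
  obtain ⟨W, hW, hM, hWc⟩ := exists_generator_enumeration hf
  have hmem : ∀ i : ↥(Finset.Icc 1 (s - 1)), 1 ≤ (i : ℕ) ∧ (i : ℕ) ≤ s - 1 :=
    fun i => Finset.mem_Icc.1 i.2
  have hirr : ∀ i : ↥(Finset.Icc 1 (s - 1)), Fact (Irreducible (f i)) :=
    fun i => ⟨(hf i (hmem i).1 (hmem i).2).1.2.1⟩
  have hmon : ∀ i : ↥(Finset.Icc 1 (s - 1)), (f i).Monic :=
    fun i => (hf i (hmem i).1 (hmem i).2).1.1
  have hdeg : ∀ i : ↥(Finset.Icc 1 (s - 1)), (f i).natDegree = i * k + h :=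
    fun i => (hf i (hmem i).1 (hmem i).2).2
  have hblock : ∀ i : ↥(Finset.Icc 1 (s - 1)),
      (s - i - 1) * k + k + (i * k + h) = s * k + h :=
    fun i => block_add (hmem i).1 (hmem i).2
  have hkN : ∀ i : ↥(Finset.Icc 1 (s - 1)), k ≤ i * k + h :=
    fun i => (Nat.le_mul_of_pos_left k (hmem i).1).trans (Nat.le_add_right _ _)
  have hmul : ∀ a b c : ℕ, a + c ≤ b → a * k + c * k ≤ b * k := fun a b c hab => by
    rw [← add_mul]
    exact Nat.mul_le_mul_right k hab
  have h3k := hmul 0 s 3 (by omega)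
  -- All rows span pairwise different hyperplanes.
  have hhyp : Function.Injective fun x => rowSpace (firstRows (W x) (s * k + h - 1)) := by
    have hM' : ∀ x, rowSpace (firstRows (W (some x)) (s * k + h - 1)) ≠
        rowSpace (firstRows (W none) (s * k + h - 1)) := fun ⟨i, γ⟩ => by
      rw [hM]
      exact (hWc ⟨i, γ⟩).hyperplane_ne_matM (hblock i) (hmon i) (hdeg i) (hkN i) (by omega)
        (by omega)
    have hlt : ∀ x y, x.1.1 < y.1.1 → rowSpace (firstRows (W (some x)) (s * k + h - 1)) ≠
        rowSpace (firstRows (W (some y)) (s * k + h - 1)) := by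
      rintro ⟨i, γ⟩ ⟨i', γ'⟩ hii
      refine (hWc ⟨i, γ⟩).hyperplane_ne_of_lt (hWc ⟨i', γ'⟩) (hblock i) (hblock i') (hmon i)
        (hdeg i) (hkN i) (hmon i') (hdeg i') (hkN i') (by omega) ?_
      dsimp only at hii ⊢
      have hb := hblock i
      have hb' := hblock i'
      rcases Nat.lt_or_ge (i.1 + 1) i'.1 with h2 | h2
      · have := hmul i i' 2 h2
        exact Or.inr (by omega)
      · have e : i'.1 * k = i.1 * k + k := by rw [show i'.1 = i.1 + 1 by omega, add_mul, one_mul]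
        exact Or.inl (by omega)
    intro x y hxy
    dsimp only at hxy
    rcases x with _ | ⟨i, γ⟩ <;> rcases y with _ | ⟨i', γ'⟩
    · rfl
    · exact absurd hxy.symm (hM' _)
    · exact absurd hxy (hM' _)
    rcases lt_trichotomy i.1 i'.1 with hii | hii | hii
    · exact absurd hxy (hlt _ _ hii)
    · obtain rfl := Subtype.ext hii
      by_contra hne
      have hγ : γ ≠ γ' := fun e => hne (by rw [e])
      have hk0 : 0 < k := by omega
      by_cases h0 : γ = 0
      · exact (hWc ⟨i, γ⟩).hyperplane_ne_of_eq_zero (hWc ⟨i, γ'⟩) (hblock i) (hmon i)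
          (hdeg i) (hkN i) hk0 h0 (fun e => hγ (h0.trans e.symm)) hxy
      by_cases h0' : γ' = 0
      · exact (hWc ⟨i, γ'⟩).hyperplane_ne_of_eq_zero (hWc ⟨i, γ⟩) (hblock i) (hmon i)
          (hdeg i) (hkN i) hk0 h0' h0 hxy.symm
      · have := hblock i
        exact (hWc ⟨i, γ⟩).hyperplane_ne_of_ne_zero (hWc ⟨i, γ'⟩) (hblock i) (hmon i)
          (hdeg i) (hkN i) hk0 h0 h0' hγ (by dsimp only; omega) hxy
    · exact absurd hxy.symm (hlt _ _ hii)
  refine ⟨fun m hm => ?_, ?_, ?_⟩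
  -- With `j = 1` for `m ≤ k + h`, the left block of type `i` is reached exactly if `i < j`.
  · obtain ⟨j, hj1, hjs, hs5, hle, hlt, hkm, hmn⟩ : ∃ j, 1 ≤ j ∧ j + 2 ≤ s ∧ (2 ≤ j → 5 ≤ s) ∧
        (∀ l, j ≤ l → m ≤ l * k + h) ∧ (1 < j → m = j * k + h) ∧ k ≤ m ∧
        m + 2 * k ≤ s * k + h := by
      rcases hm with hm | ⟨j, hj, hjs, rfl⟩
      · refine ⟨1, le_rfl, by omega, by omega, fun l hl => ?_, by omega, by omega, by omega⟩
        have := hmul 0 l 1 (by omega)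
        omega
      · have h1 := hmul 0 j 1 (by omega)
        have h2 := hmul j s 2 (by omega)
        refine ⟨j, by omega, by omega, by omega, fun l hl => ?_, fun _ => rfl, by omega, by omega⟩
        have := hmul j l 0 hl
        omega
    have hm1 : m ≤ s * k + h - 1 := by omega
    have hdim : ∀ x, Module.finrank F (rowSpace (firstRows (W x) m)) = m := by
      rintro (_ | ⟨i, γ⟩)
      · rw [hM]
        exact finrank_rowSpace_matM hm1
      · have := hblock i
        exact (hWc ⟨i, γ⟩).finrank_rowSpace (hblock i) (hmon i) (hdeg i) (by dsimp only; omega)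
          hm1
    have hdistM : ∀ x, Module.finrank F ↥(rowSpace (firstRows (W (some x)) m) ⊓
        rowSpace (firstRows (W none) m)) + k ≤ m := by
      rintro ⟨i, γ⟩
      conv_rhs => rw [← hdim (some ⟨i, γ⟩)]
      rw [hM]
      refine (hWc ⟨i, γ⟩).finrank_inf_matM_add_le (hblock i) (hmon i) (hdeg i) (hkN i) hkm
        hm1 hmn ?_
      dsimp only
      by_cases hji : j ≤ i
      · exact Or.inl (hle i hji)
      · have h1 := hlt (by have := (hmem i).1; omega)
        have := hmul i j 1 (by omega)
        exact Or.inr (by omega)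
    have hdistlt : ∀ x y, x.1.1 < y.1.1 →
        Module.finrank F ↥(rowSpace (firstRows (W (some x)) m) ⊓
          rowSpace (firstRows (W (some y)) m)) + k ≤ m := by
      rintro ⟨i, γ⟩ ⟨i', γ'⟩ hii
      exact finrank_inf_add_le_of_lt (hmem i).1 hii (hmem i').2 hjs hs5 hle hlt hhk hkm hmn
        (hmon i) (hdeg i) (hmon i') (hdeg i') (hWc ⟨i, γ⟩) (hWc ⟨i', γ'⟩) (hdim _) (hdim _)
    obtain ⟨hinj, hmin⟩ := injective_and_minDist_range (by omega : 0 < k)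
      (fun x => rowSpace (firstRows (W x) m)) hdim (by
        intro x y hxy
        rcases x with _ | ⟨i, γ⟩ <;> rcases y with _ | ⟨i', γ'⟩
        · exact absurd rfl hxy
        · rw [inf_comm]
          exact hdistM _
        · exact hdistM _
        rcases lt_trichotomy i.1 i'.1 with hii | hii | hii
        · exact hdistlt _ _ hii
        · obtain rfl := Subtype.ext hii
          have hγ : γ ≠ γ' := fun e => hxy (by rw [e])
          have hmN : m ≤ i.1 * k + h + (s - i.1 - 1) * k := by
            have := hblock i
            omega
          by_cases h0 : γ = 0
          · exact (hWc ⟨i, γ⟩).finrank_inf_add_le_of_eq_zero (hWc ⟨i, γ'⟩) (hblock i) (hmon i)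
              (hdeg i) (hkN i) hkm hmN hm1 h0 (fun e => hγ (h0.trans e.symm))
          by_cases h0' : γ' = 0
          · rw [inf_comm]
            exact (hWc ⟨i, γ'⟩).finrank_inf_add_le_of_eq_zero (hWc ⟨i, γ⟩) (hblock i) (hmon i)
              (hdeg i) (hkN i) hkm hmN hm1 h0' h0
          · exact (hWc ⟨i, γ⟩).finrank_inf_add_le_of_ne_zero (hWc ⟨i, γ'⟩) (hblock i) (hmon i)
              (hdeg i) (hkN i) hkm hmN h0 h0' hγ
        · rw [inf_comm]
          exact hdistlt _ _ hii)
      (by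
        -- `B_i` and `A_i` for `i = s - 1`, which differ in their first `k` rows only.
        let i : ↥(Finset.Icc 1 (s - 1)) := ⟨s - 1, Finset.mem_Icc.2 ⟨by omega, le_rfl⟩⟩
        refine ⟨some ⟨i, 0⟩, some ⟨i, 1⟩, by simp, ?_⟩
        exact le_finrank_inf_add (hWc ⟨i, 0⟩) (hWc ⟨i, 1⟩) (hblock i) (hmon i) (hdeg i) rfl rfl
          hm1 (hle (s - 1) (by omega)))
    have hproj : projectedCode (flagCode s k h f) m =
        Set.range fun x => rowSpace (firstRows (W x) m) := by
      rw [flagCode, projectedCode_flagCode _ ⟨by omega, hm1⟩, ← hW, ← Set.range_comp]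
      rfl
    rw [hproj]
    refine ⟨?_, hmin, ?_⟩
    · rintro _ ⟨x, rfl⟩
      exact hdim x
    · rw [← natCard_generatorIndex hf]
      exact Set.ncard_range_of_injective hinj
  · rw [flagCode, ← hW, ← Set.range_comp, ← natCard_generatorIndex hf]
    refine Set.ncard_range_of_injective fun x y hxy => hhyp ?_
    exact congrFun hxy ⟨s * k + h - 1, by omega, le_rfl⟩
  · rw [subspaceCode, ← hW, ← Set.range_comp, ← natCard_generatorIndex hf]
    refine Set.ncard_range_of_injective fun x y hxy => hhyp ?_
    simpa only [Function.comp_apply, rowSpace_eq_firstRows] using hxy
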